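/- Let $K\ge 0$ be an integer and $S \subset \mathbb{Z}_+^K\times\mathbb{Z}_+^K$ an arbitrary subset. Write $x=(x_{i,k})$, $i\in\{1,2\}$, $k\in\{1,\dots,K\}$, for its elements, $|x|=\sum_{i,k}x_{i,k}$, and $e_{i,k}$ for the unit vectors. Define the preorder $x\preceq y$ on $S$ by: $x_{1,k}\le y_{1,k}$ for all $k$ and $|x|\le|y|$. Let $D(\mathbb{R}_+,S)$ be the Skorohod space of right-continuous functions with left-hand limits from $\mathbb{R}_+$ to the discrete space $S$, with its usual $\sigma$-algebra (generated by the maps $f\mapsto f(t)$), and write $f\preceq g$ if $f(t)\preceq g(t)$ for all $t\ge 0$. For random elements $U,V$ of $S$ or of $D(\mathbb{R}_+,S)$ (possibly defined on different probability spaces) write $U\le_{\mathrm{st}}V$ if $\operatorname{E}f(U)\le\operatorname{E}f(V)$ for every bounded measurable real function $f$ that is increasing with respect to $\preceq$. Let $\lambda_{i,k},\phi_{i,k},\lambda'_{i,k},\phi'_{i,k}$ be bounded nonnegative functions on $S$ such that $\lambda_{i,k}(x)=\lambda'_{i,k}(x)=0$ whenever $x+e_{i,k}\notin S$ and $\phi_{i,k}(x)=\phi'_{i,k}(x)=0$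 whenever $x-e_{i,k}\notin S$. Let $X$ and $Y$ be time-homogeneous continuous-time Markov processes with paths in $D(\mathbb{R}_+,S)$, where $X$ makes the transitions $x\mapsto x+e_{i,k}$ at rate $\lambda_{i,k}(x)$ and $x\mapsto x-e_{i,k}$ at rate $\phi_{i,k}(x)$, and $Y$ makes the same transitions at rates $\lambda'_{i,k}(x)$ and $\phi'_{i,k}(x)$, respectively. (That is, each process has the Markov property for a transition function $p_h(x,y)=1(x=y)+q(x,y)h+o(h)$ as $h\downarrow0$, for all $x,y\in S$, where $q$ is the generator given by these rates.) Assume: (i) for all $x,y\in S$ and all $k$ such that $x\preceq y$ and $x_{1,k}=y_{1,k}$, $$\lambda_{1,k}(x)\le\lambda'_{1,k}(y),\qquad \phi_{1,k}(x)\ge\phi'_{1,k}(y);$$ (ii) for all $x,y\in S$ such that $x\preceq y$ and $|x|=|y|$, $$\sum_{i,k}\lambda_{i,k}(x)\le\sum_{i,k}\lambda'_{i,k}(y),\qquad \sum_{i,k}\phi_{i,k}(x)\ge\sum_{i,k}\phi'_{i,k}(y).$$ If the initial states satisfy $X(0)\le_{\mathrm{st}}Y(0)$ (in particular, if $X(0)\preceq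 Y(0)$ almost surely, or if they are deterministic with $X(0)\preceq Y(0)$), then $X\le_{\mathrm{st}}Y$ as random elements of $D(\mathbb{R}_+,S)$. -/

import Mathlib

open MeasureTheory Filter Topology
open scoped NNReal

/-- `ℤ₊^K × ℤ₊^K`. The first index is the layer (`0` is layer 1, `1` is layer 2), the second one
is the customer class. -/
abbrev State (K : ℕ) : Type := Fin 2 → Fin K → ℕ

/-- The unit vector `e_{i,k}`. -/
def unitVec {K : ℕ} (i : Fin 2) (k : Fin K) : State K := Pi.single i (Pi.single k 1)

/-- `|x|`, the sum of all coordinates. -/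
def total {K : ℕ} (x : State K) : ℕ := ∑ i, ∑ k, x i k

/-- The preorder `x ⪯ y`: `x_{1,k} ≤ y_{1,k}` for all `k`, and `|x| ≤ |y|`. -/
def Prec {K : ℕ} (x y : State K) : Prop := (∀ k, x 0 k ≤ y 0 k) ∧ total x ≤ total y

/-- The Skorohod space `D(ℝ₊, E)` of right-continuous functions with left-hand limits. -/
def SkorohodSpace (E : Type*) [TopologicalSpace E] : Type _ :=
  {f : ℝ≥0 → E // (∀ t, ContinuousWithinAt f (Set.Ici t) t) ∧
    ∀ t, 0 < t → ∃ l, Tendsto f (𝓝[<] t) (𝓝 l)}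

namespace SkorohodSpace

/-- The value `f(t)`. -/
def eval {E : Type*} [TopologicalSpace E] (f : SkorohodSpace E) (t : ℝ≥0) : E := f.1 t

/-- The usual sigma-algebra of the Skorohod space, generated by the maps `f ↦ f(t)`. -/
instance {E : Type*} [TopologicalSpace E] [MeasurableSpace E] :
    MeasurableSpace (SkorohodSpace E) :=
  ⨆ t : ℝ≥0, MeasurableSpace.comap (fun f => f.eval t) inferInstance

end SkorohodSpace

/-- The preorder `f ⪯ g` on paths: `f(t) ⪯ g(t)` for all `t`. -/
def PathPrec {K : ℕ} {S : Set (State K)} (f g : SkorohodSpace S) : Prop :=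
  ∀ t, Prec (f.eval t : State K) (g.eval t)

/-- `U ≤_st V` with respect to the relation `r`: `E φ(U) ≤ E φ(V)` for all bounded measurable
functions `φ` that are increasing with respect to `r`. -/
def StochLE {E Ω Ω' : Type*} [MeasurableSpace E] [MeasurableSpace Ω] [MeasurableSpace Ω']
    (r : E → E → Prop) (P : Measure Ω) (U : Ω → E) (P' : Measure Ω') (V : Ω' → E) : Prop :=
  ∀ φ : E → ℝ, Measurable φ → (∃ C, ∀ a, |φ a| ≤ C) → (∀ a b, r a b → φ a ≤ φ b) →
    ∫ ω, φ (U ω) ∂P ≤ ∫ ω, φ (V ω) ∂P'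

/-- Bounded nonnegative rates on `S` of the transitions `x ↦ x + e_{i,k}` (`up i k x`) and
`x ↦ x - e_{i,k}` (`down i k x`), vanishing where the transition would leave `S`. -/
structure UnitRates {K : ℕ} (S : Set (State K)) where
  up : Fin 2 → Fin K → S → ℝ
  down : Fin 2 → Fin K → S → ℝ
  up_nonneg : ∀ i k x, 0 ≤ up i k x
  down_nonneg : ∀ i k x, 0 ≤ down i k x
  up_bounded : ∀ i k, ∃ C, ∀ x, up i k x ≤ C
  down_bounded : ∀ i k, ∃ C, ∀ x, down i k x ≤ C
  up_eq_zero : ∀ i k (x : S), (x : State K) + unitVec i k ∉ S → up i k x = 0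
  down_eq_zero : ∀ i k (x : S), (∀ y ∈ S, y + unitVec i k ≠ (x : State K)) → down i k x = 0

open Classical in
/-- The infinitesimal generator `q(x,y)`: off the diagonal, the total rate of the transitions from
`x` to `y`; on the diagonal, minus the total rate out of `x`. -/
noncomputable def UnitRates.generator {K : ℕ} {S : Set (State K)} (R : UnitRates S)
    (x y : S) : ℝ :=
  (∑ i, ∑ k, R.up i k x *
    ((if (y : State K) = (x : State K) + unitVec i k then 1 else 0) - (if y = x then 1 else 0))) +
  (∑ i, ∑ k, R.down i k x *
    ((if (y : State K) + unitVec i k = (x : State K) then 1 else 0) - (if y = x then 1 else 0)))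

open Classical in
/-- `p t x y` is a (stochastic) Markov transition function on the countable set `E`. -/
structure IsTransitionFunction {E : Type*} (p : ℝ≥0 → E → E → ℝ) : Prop where
  nonneg : ∀ t x y, 0 ≤ p t x y
  hasSum_one : ∀ t x, HasSum (p t x) 1
  zero : ∀ x y, p 0 x y = if x = y then 1 else 0
  chapman_kolmogorov : ∀ s t x y, HasSum (fun z => p s x z * p t z y) (p (s + t) x y)

/-- The process `X` with paths in `D(ℝ₊, S)` is a (time-homogeneous) Markov process with the
transition rates `R`: it has the Markov property for a transition function
`p h x y = 1(x = y) + q(x,y) h + o(h)` as `h ↓ 0`. -/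
structure IsMarkovWithRates {K : ℕ} {S : Set (State K)} (R : UnitRates S)
    {Ω : Type*} [MeasurableSpace Ω] (P : Measure Ω) (X : Ω → SkorohodSpace S) : Prop where
  measurable : Measurable X
  markov : ∃ p : ℝ≥0 → S → S → ℝ, IsTransitionFunction p ∧
    (∀ x y, Tendsto (fun h : ℝ≥0 => (p h x y - p 0 x y) / (h : ℝ)) (𝓝[>] 0)
      (𝓝 (R.generator x y))) ∧
    ∀ (n : ℕ) (t : Fin (n + 1) → ℝ≥0) (x : Fin (n + 1) → S), Monotone t → ∀ (h : ℝ≥0) (y : S),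
      P {ω | (∀ j, (X ω).eval (t j) = x j) ∧ (X ω).eval (t (Fin.last n) + h) = y} =
        P {ω | ∀ j, (X ω).eval (t j) = x j} * ENNReal.ofReal (p h (x (Fin.last n)) y)

/-! The two processes are realized on one probability space in such a way that `X t ⪯ Y t` for all
`t`, for every pair of initial states `x ⪯ y`.

*Coupling.* All rates are bounded, so both processes can be uniformized: for a large `Λ`, each of
them makes a random move (possibly none) at every tick of a Poisson clock of rate `Λ`, with the
one-step law `stepLaw`. For `x ⪯ y` the moves of the two processes are coupled by a matrix of
weights (`exists_moveProb_coupling`). An upward move of `X` can break the order only if it is in a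
coordinate of layer 1 in which `x` and `y` agree, or if `|x| = |y|`; in the first case it is matched
with the same move of `Y`, which condition (i) permits, and in the second case with some upward move
of `Y`, which condition (ii) permits. The downward moves of `Y` are treated in the same way, with
the roles of the two processes exchanged. The coupled chain lives on the set `OrderedPair S`, and
both marginals have the right one-step laws.

*The process in continuous time.* From the one-step laws `K e` of a chain on a countable set `E`, a
process with paths in the Skorohod space is built from a sequence of independent pairs, each an
exponential waiting time and a random map `E → E` (`path`). Conditioning on the first tick
(`lintegral_hasJumps`) shows that at time `t` the state is independent of the noise still to come,
which is again distributed as at the beginning. This gives the Markov property of the process and of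
its projections (`isMarkovWithRates_path`).

*Uniqueness.* A transition function with bounded conservative generator is determined by the
generator (`IsTransitionFunction.eq_of_generator`), hence rates and initial law determine the law on
the Skorohod space (`IsMarkovWithRates.map_eq`). So expectations of functionals of `X`, of `Y`, and
of the marginals of the coupled process can all be compared with each other.

*Initial states.* For an increasing `φ` let `h x` and `h' x` be the expectations of `φ` for the two
processes started at `x`. The coupling gives `h x ≤ h' y` for `x ⪯ y`, so that
`g x = sup {h z | z ⪯ x}` is increasing and `h ≤ g ≤ h'`. Applying the stochastic order of the
initial states to `g` concludes the proof, and no coupling of the initial states is needed. -/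

open ProbabilityTheory
open scoped ENNReal

/-! ### Exponential clocks and Poisson weights -/

/-- The probability that a Poisson process of rate `Λ` has exactly `n` points in `[0, t]`. -/
noncomputable def poissonWeight (Λ t : ℝ) (n : ℕ) : ℝ :=
  Real.exp (-(Λ * t)) * (Λ * t) ^ n / n.factorial

lemma poissonWeight_nonneg {Λ t : ℝ} (hΛ : 0 < Λ) (ht : 0 ≤ t) (n : ℕ) :
    0 ≤ poissonWeight Λ t n := by
  have : 0 ≤ Λ * t := by positivity
  unfold poissonWeight
  positivity

lemma hasSum_poissonWeight {Λ t : ℝ} (hΛ : 0 < Λ) (ht : 0 ≤ t) :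
    HasSum (poissonWeight Λ t) 1 :=
  hasSum_one_poissonMeasure ⟨Λ * t, by positivity⟩

lemma tsum_ofReal_poissonWeight {Λ t : ℝ} (hΛ : 0 < Λ) (ht : 0 ≤ t) :
    ∑' n, ENNReal.ofReal (poissonWeight Λ t n) = 1 := by
  rw [← ENNReal.ofReal_tsum_of_nonneg (poissonWeight_nonneg hΛ ht)
      (hasSum_poissonWeight hΛ ht).summable,
    (hasSum_poissonWeight hΛ ht).tsum_eq, ENNReal.ofReal_one]

lemma lintegral_expMeasure (Λ : ℝ) {F : ℝ → ℝ≥0∞} (hF : Measurable F) :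
    ∫⁻ s, F s ∂(expMeasure Λ) =
      ∫⁻ s, (Set.Ici (0 : ℝ)).indicator (fun s => ENNReal.ofReal (Λ * Real.exp (-(Λ * s)))) s * F s
        := by
  have hm : Measurable (exponentialPDF Λ) := (measurable_exponentialPDFReal Λ).ennreal_ofReal
  have : expMeasure Λ = volume.withDensity (exponentialPDF Λ) := rfl
  rw [this, lintegral_withDensity_eq_lintegral_mul _ hm hF]
  refine lintegral_congr fun s => ?_
  rw [Pi.mul_apply, exponentialPDF_eq]
  by_cases hs : 0 ≤ s <;> simp [hs]

/-- The lack of memory of the exponential law. -/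
lemma lintegral_expMeasure_shift {Λ t : ℝ} (ht : 0 ≤ t) {F : ℝ → ℝ≥0∞}
    (hF : Measurable F) :
    ∫⁻ s, (Set.Ioi t).indicator (fun s => F (s - t)) s ∂(expMeasure Λ) =
      ENNReal.ofReal (Real.exp (-(Λ * t))) * ∫⁻ s, F s ∂(expMeasure Λ) := by
  have hne : ∀ᵐ s : ℝ ∂volume, s ≠ t := by simp [ae_iff, measure_singleton]
  have hF' : Measurable fun s => F (s - t) := hF.comp (measurable_id.sub_const t)
  rw [lintegral_expMeasure Λ (hF'.indicator measurableSet_Ioi),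
    lintegral_expMeasure Λ hF,
    ← lintegral_sub_right_eq_self (fun s => (Set.Ici (0 : ℝ)).indicator
      (fun s => ENNReal.ofReal (Λ * Real.exp (-(Λ * s)))) s * F s) t,
    ← lintegral_const_mul' _ _ ENNReal.ofReal_ne_top]
  refine lintegral_congr_ae ?_
  filter_upwards [hne] with s hs
  rcases lt_or_gt_of_ne hs with h | h
  · simp [h.not_gt, h]
  · have h0 : 0 ≤ s := by linarith
    simp only [Set.mem_Ici, h0, Set.indicator_of_mem, Set.mem_Ioi, h, sub_nonneg, h.le]
    rw [← mul_assoc, ← ENNReal.ofReal_mul (Real.exp_nonneg _)]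
    congr 2
    rw [mul_left_comm, ← Real.exp_add]
    ring_nf

/-- Conditioning on the first point: it falls at `s ≤ t`, and `n` more points fall in `(s, t]`. -/
lemma lintegral_poissonWeight_sub {Λ t : ℝ} (hΛ : 0 < Λ) (ht : 0 ≤ t) (n : ℕ) :
    ∫⁻ s, (Set.Iic t).indicator (fun s => ENNReal.ofReal (poissonWeight Λ (t - s) n)) s
      ∂(expMeasure Λ) = ENNReal.ofReal (poissonWeight Λ t (n + 1)) := by
  have hmeas : Measurable fun s => ENNReal.ofReal (poissonWeight Λ (t - s) n) := by
    unfold poissonWeight; fun_prop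
  rw [lintegral_expMeasure Λ (hmeas.indicator measurableSet_Iic)]
  have hint : ∫⁻ s, (Set.Ici (0 : ℝ)).indicator
        (fun s => ENNReal.ofReal (Λ * Real.exp (-(Λ * s)))) s *
        (Set.Iic t).indicator (fun s => ENNReal.ofReal (poissonWeight Λ (t - s) n)) s =
      ∫⁻ s in Set.Icc 0 t, ENNReal.ofReal
        (Λ * Real.exp (-(Λ * t)) * (Λ * (t - s)) ^ n / n.factorial) := by
    rw [← lintegral_indicator measurableSet_Icc]
    refine lintegral_congr fun s => ?_
    by_cases h0 : 0 ≤ s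
    · by_cases h1 : s ≤ t
      · simp only [Set.mem_Ici, h0, Set.indicator_of_mem, Set.mem_Iic, h1, Set.mem_Icc, and_self]
        rw [← ENNReal.ofReal_mul (by positivity)]
        congr 1
        unfold poissonWeight
        have : Real.exp (-(Λ * t)) = Real.exp (-(Λ * s)) * Real.exp (-(Λ * (t - s))) := by
          rw [← Real.exp_add]; ring_nf
        rw [this]; ring
      · simp [h1]
    · simp [h0]
  have hderiv : ∀ s ∈ Set.uIcc 0 t, HasDerivAt
      (fun s => -(Real.exp (-(Λ * t)) * (Λ * (t - s)) ^ (n + 1) / (n + 1).factorial))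
      (Λ * Real.exp (-(Λ * t)) * (Λ * (t - s)) ^ n / n.factorial) s := by
    intro s _
    have h1 : HasDerivAt (fun s => Λ * (t - s)) (-Λ) s := by
      simpa using ((hasDerivAt_id s).const_sub t).const_mul Λ
    refine (((h1.pow (n + 1)).const_mul (Real.exp (-(Λ * t)))).div_const
      ((n + 1).factorial : ℝ)).neg.congr_deriv ?_
    rw [Nat.factorial_succ]
    push_cast
    have : (n.factorial : ℝ) ≠ 0 := by positivity
    have h2 : (n + 1 : ℝ) ≠ 0 := by positivity
    field_simp
  have hcont : Continuous fun s : ℝ =>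
      Λ * Real.exp (-(Λ * t)) * (Λ * (t - s)) ^ n / n.factorial := by fun_prop
  rw [hint, ← ofReal_integral_eq_lintegral_ofReal hcont.integrableOn_Icc,
    integral_Icc_eq_integral_Ioc,
    ← intervalIntegral.integral_of_le ht,
    intervalIntegral.integral_eq_sub_of_hasDerivAt hderiv (hcont.intervalIntegrable _ _)]
  · simp [poissonWeight]
  · refine (ae_restrict_iff' measurableSet_Icc).2 (Eventually.of_forall fun s hs => ?_)
    have : 0 ≤ t - s := sub_nonneg.2 hs.2
    simp only [Pi.zero_apply]
    positivity

/-! ### Sequences of independent marks -/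

/-- The sequence `a, u 0, u 1, …`. -/
def consSeq {A : Type*} (a : A) (u : ℕ → A) : ℕ → A
  | 0 => a
  | n + 1 => u n

lemma measurable_consSeq {A : Type*} [MeasurableSpace A] :
    Measurable fun p : A × (ℕ → A) => consSeq p.1 p.2 := by
  refine measurable_pi_iff.2 fun n => ?_
  cases n with
  | zero => exact measurable_fst
  | succ n => exact (measurable_pi_apply n).comp measurable_snd

lemma map_consSeq {A : Type*} [MeasurableSpace A] (ρ : Measure A) [IsProbabilityMeasure ρ] :
    (ρ.prod (Measure.infinitePi fun _ : ℕ => ρ)).map (fun p => consSeq p.1 p.2) =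
      Measure.infinitePi fun _ : ℕ => ρ := by
  classical
  refine Measure.eq_infinitePi _ fun s t ht => ?_
  obtain ⟨n, hn⟩ := s.exists_nat_subset_range
  have hn' : s ⊆ Finset.range (n + 1) := hn.trans (Finset.range_mono n.le_succ)
  -- Pad with the whole space, so that the index set becomes an initial segment.
  set t' : ℕ → Set A := fun i => if i ∈ s then t i else Set.univ with ht'
  have hmt' : ∀ i, MeasurableSet (t' i) := fun i => by
    by_cases h : i ∈ s <;> simp [ht', h, ht]
  have hpi : (s : Set ℕ).pi t = (Finset.range (n + 1) : Set ℕ).pi t' := by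
    ext u
    simp only [Set.mem_pi, Finset.mem_coe, ht']
    refine ⟨fun h i _ => ?_, fun h i hi => by simpa [hi] using h i (hn' hi)⟩
    by_cases hi : i ∈ s <;> simp [hi, h]
  have hprod : ∏ i ∈ s, ρ (t i) = ∏ i ∈ Finset.range (n + 1), ρ (t' i) := by
    rw [← Finset.prod_subset hn' (fun i _ hi => by simp [ht', hi])]
    exact Finset.prod_congr rfl fun i hi => by simp [ht', hi]
  have hpre : (fun p : A × (ℕ → A) => consSeq p.1 p.2) ⁻¹' (Finset.range (n + 1) : Set ℕ).pi t' =
      t' 0 ×ˢ (Finset.range n : Set ℕ).pi fun i => t' (i + 1) := by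
    ext ⟨a, u⟩
    simp only [Set.mem_preimage, Set.mem_pi, Finset.mem_coe, Finset.mem_range, Set.mem_prod]
    refine ⟨fun h => ⟨h 0 (by omega), fun i hi => h (i + 1) (by omega)⟩, fun h i hi => ?_⟩
    cases i with
    | zero => exact h.1
    | succ i => exact h.2 i (by omega)
  rw [hpi, hprod, Measure.map_apply measurable_consSeq
    (MeasurableSet.pi (Finset.countable_toSet _) fun i _ => hmt' i), hpre, Measure.prod_prod,
    Measure.infinitePi_pi _ (fun i _ => hmt' _), Finset.prod_range_succ', mul_comm]

lemma lintegral_infinitePi_cons {A : Type*} [MeasurableSpace A] (ρ : Measure A)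
    [IsProbabilityMeasure ρ] {F : (ℕ → A) → ℝ≥0∞} (hF : Measurable F) :
    ∫⁻ u, F u ∂(Measure.infinitePi fun _ : ℕ => ρ) =
      ∫⁻ a, ∫⁻ u, F (consSeq a u) ∂(Measure.infinitePi fun _ : ℕ => ρ) ∂ρ := by
  conv_lhs => rw [← map_consSeq ρ]
  rw [lintegral_map hF measurable_consSeq]
  exact lintegral_prod _ (hF.comp measurable_consSeq).aemeasurable

instance {Λ : ℝ} [hΛ : Fact (0 < Λ)] : IsProbabilityMeasure (expMeasure Λ) :=
  isProbabilityMeasure_expMeasure hΛ.out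

/-! ### The jump chain driven by a Poisson clock -/

/-- The randomness driving a chain on `E`: the waiting time before each tick of the clock, and the
map that is applied to the current state at that tick. -/
abbrev Noise (E : Type*) : Type _ := ℕ → ℝ × (E → E)

/-- Independent exponential waiting times of rate `Λ` and independent random maps, whose values at
the points `e` are independent of law `K e`. Only the marginal laws of these values matter, as each
map is applied to a single state. -/
noncomputable def noiseLaw {E : Type*} [MeasurableSpace E] (K : E → Measure E)
    [∀ e, IsProbabilityMeasure (K e)] (Λ : ℝ) [Fact (0 < Λ)] : Measure (Noise E) :=
  Measure.infinitePi fun _ => (expMeasure Λ).prod (Measure.infinitePi K)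

/-- The clock ticks exactly `n` times in `[0, t]`: tick number `n + 1` is the first one after `t`.
With this reading, no positivity of the waiting times is needed. -/
def HasJumps {E : Type*} : ℕ → ℝ → Noise E → Prop
  | 0, t, u => t < (u 0).1
  | n + 1, t, u => (u 0).1 ≤ t ∧ HasJumps n (t - (u 0).1) fun k => u (k + 1)

/-- The state after `n` ticks, from the initial state `e`. -/
def chain {E : Type*} : ℕ → E → Noise E → E
  | 0, e, _ => e
  | n + 1, e, u => chain n ((u 0).2 e) fun k => u (k + 1)

/-- The noise seen from time `t`, if the clock has ticked `n` times in `[0, t]`. -/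
def future {E : Type*} : ℕ → ℝ → Noise E → Noise E
  | 0, t, u => consSeq ((u 0).1 - t, (u 0).2) fun k => u (k + 1)
  | n + 1, t, u => future n (t - (u 0).1) fun k => u (k + 1)

/-- The law of a chain with step `K` after `n` steps. -/
noncomputable def powLaw {E : Type*} [MeasurableSpace E] (K : E → Measure E) : ℕ → E → Measure E
  | 0, e => Measure.dirac e
  | n + 1, e => (K e).bind (powLaw K n)

section Pathwise

variable {E : Type*}

lemma HasJumps.unique {n m : ℕ} {t : ℝ} {u : Noise E} (hn : HasJumps n t u)
    (hm : HasJumps m t u) : n = m := by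
  induction n generalizing m t u with
  | zero =>
    cases m with
    | zero => rfl
    | succ m => exact absurd hm.1 (not_le.2 hn)
  | succ n ih =>
    cases m with
    | zero => exact absurd hn.1 (not_le.2 hm)
    | succ m => rw [ih hn.2 hm.2]

lemma HasJumps.mono {n m : ℕ} {s t : ℝ} {u : Noise E} (hst : s ≤ t) (hn : HasJumps n s u)
    (hm : HasJumps m t u) : n ≤ m := by
  induction n generalizing m s t u with
  | zero => exact m.zero_le
  | succ n ih =>
    cases m with
    | zero => exact absurd (hn.1.trans hst) (not_le.2 hm)
    | succ m => exact Nat.succ_le_succ (ih (by linarith) hn.2 hm.2)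

lemma HasJumps.exists_of_le {m : ℕ} {s t : ℝ} {u : Noise E} (hst : s ≤ t)
    (hm : HasJumps m t u) : ∃ n, HasJumps n s u := by
  induction m generalizing s t u with
  | zero => exact ⟨0, lt_of_le_of_lt hst hm⟩
  | succ m ih =>
    by_cases h : s < (u 0).1
    · exact ⟨0, h⟩
    · obtain ⟨n, hn⟩ := ih (sub_le_sub_right hst (u 0).1) hm.2
      exact ⟨n + 1, not_lt.1 h, hn⟩

lemma HasJumps.eventually_right {n : ℕ} {t : ℝ} {u : Noise E} (hn : HasJumps n t u) :
    ∃ δ > 0, ∀ s, t ≤ s → s < t + δ → HasJumps n s u := by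
  induction n generalizing t u with
  | zero => exact ⟨(u 0).1 - t, sub_pos.2 hn, fun s _ hs => by
      simp only [HasJumps]; linarith⟩
  | succ n ih =>
    obtain ⟨δ, hδ, h⟩ := ih hn.2
    exact ⟨δ, hδ, fun s h1 h2 => ⟨hn.1.trans h1, h _ (by linarith) (by linarith)⟩⟩

lemma chain_future_zero (m : ℕ) (e : E) (t : ℝ) (u : Noise E) :
    chain m e (future 0 t u) = chain m e u := by
  cases m <;> rfl

lemma chain_add (n m : ℕ) (e : E) (t : ℝ) (u : Noise E) :
    chain m (chain n e u) (future n t u) = chain (n + m) e u := by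
  induction n generalizing e t u with
  | zero => rw [Nat.zero_add, ← chain_future_zero m e t u]; rfl
  | succ n ih => rw [Nat.succ_add]; exact ih _ _ _

lemma HasJumps.add {n m : ℕ} {t h : ℝ} {u : Noise E} (hh : 0 ≤ h) (hn : HasJumps n t u)
    (hm : HasJumps m h (future n t u)) : HasJumps (n + m) (t + h) u := by
  induction n generalizing t u with
  | zero =>
    rw [Nat.zero_add]
    cases m with
    | zero => simp only [HasJumps, future, consSeq] at hm ⊢; linarith
    | succ m =>
      simp only [HasJumps, future, consSeq] at hm ⊢
      refine ⟨by linarith [hm.1], ?_⟩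
      convert hm.2 using 1
      ring
  | succ n ih =>
    rw [Nat.succ_add]
    refine ⟨hn.1.trans (by linarith), ?_⟩
    have := ih hn.2 hm
    convert this using 1
    ring

end Pathwise

section Law

variable {E : Type*} [MeasurableSpace E] [DiscreteMeasurableSpace E] [Countable E]
  (K : E → Measure E) [∀ e, IsProbabilityMeasure (K e)] (Λ : ℝ) [hΛ : Fact (0 < Λ)]

instance : IsProbabilityMeasure (noiseLaw K Λ) := by unfold noiseLaw; infer_instance

instance (n : ℕ) (e : E) : IsProbabilityMeasure (powLaw K n e) := by
  induction n generalizing e with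
  | zero => unfold powLaw; infer_instance
  | succ n ih =>
    unfold powLaw
    exact isProbabilityMeasure_bind Measurable.of_discrete.aemeasurable (Eventually.of_forall ih)

lemma measurable_eval_map : Measurable fun p : E × (E → E) => p.2 p.1 :=
  measurable_from_prod_countable_right fun e => measurable_pi_apply e

omit [DiscreteMeasurableSpace E] [Countable E] in
lemma measurableSet_hasJumps (n : ℕ) : MeasurableSet {p : ℝ × Noise E | HasJumps n p.1 p.2} := by
  induction n with
  | zero =>
    exact measurableSet_lt measurable_fst
      (measurable_fst.comp ((measurable_pi_apply 0).comp measurable_snd))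
  | succ n ih =>
    have h0 : Measurable fun p : ℝ × Noise E => (p.2 0).1 :=
      measurable_fst.comp ((measurable_pi_apply 0).comp measurable_snd)
    have hs : Measurable fun p : ℝ × Noise E =>
        ((p.1 - (p.2 0).1, fun k => p.2 (k + 1)) : ℝ × Noise E) :=
      (measurable_fst.sub h0).prodMk (measurable_pi_iff.2 fun k =>
        (measurable_pi_apply (k + 1)).comp measurable_snd)
    exact (measurableSet_le h0 measurable_fst).inter (hs ih)

lemma measurable_chain (n : ℕ) : Measurable fun p : E × Noise E => chain n p.1 p.2 := by
  induction n with
  | zero => exact measurable_fst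
  | succ n ih =>
    have h0 : Measurable fun p : E × Noise E => (p.2 0).2 p.1 :=
      measurable_eval_map.comp (measurable_fst.prodMk
        (measurable_snd.comp ((measurable_pi_apply 0).comp measurable_snd)))
    exact ih.comp (h0.prodMk (measurable_pi_iff.2 fun k =>
        (measurable_pi_apply (k + 1)).comp measurable_snd))

omit [DiscreteMeasurableSpace E] [Countable E] in
lemma measurable_future (n : ℕ) : Measurable fun p : ℝ × Noise E => future n p.1 p.2 := by
  induction n with
  | zero =>
    have h0 : Measurable fun p : ℝ × Noise E => (((p.2 0).1 - p.1, (p.2 0).2) : ℝ × (E → E)) := by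
      fun_prop
    exact measurable_consSeq.comp (h0.prodMk (measurable_pi_iff.2 fun k =>
        (measurable_pi_apply (k + 1)).comp measurable_snd))
  | succ n ih =>
    have h0 : Measurable fun p : ℝ × Noise E => p.1 - (p.2 0).1 := by fun_prop
    exact ih.comp (h0.prodMk (measurable_pi_iff.2 fun k =>
        (measurable_pi_apply (k + 1)).comp measurable_snd))

/-- After `t` units of time with `n` ticks, the state has the law of `n` steps of the chain, and
the noise seen from time `t` is a fresh copy of the noise. This is proved by conditioning on the
first tick, and rests on the lack of memory of the exponential law. -/
lemma lintegral_hasJumps (n : ℕ) {t : ℝ} (ht : 0 ≤ t) (e : E) {G : E → Noise E → ℝ≥0∞}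
    (hG : Measurable (Function.uncurry G)) :
    ∫⁻ u, {u | HasJumps n t u}.indicator (fun u => G (chain n e u) (future n t u)) u
        ∂(noiseLaw K Λ) =
      ENNReal.ofReal (poissonWeight Λ t n) *
        ∫⁻ z, ∫⁻ u, G z u ∂(noiseLaw K Λ) ∂(powLaw K n e) := by
  have hm : ∀ (n : ℕ) (e : E) (t : ℝ), Measurable fun u : Noise E =>
      {u | HasJumps n t u}.indicator (fun u => G (chain n e u) (future n t u)) u := fun n e t =>
    (hG.comp (((measurable_chain n).comp (measurable_const.prodMk measurable_id)).prodMk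
      ((measurable_future n).comp (measurable_const.prodMk measurable_id)))).indicator
      ((measurable_const.prodMk measurable_id) (measurableSet_hasJumps n))
  induction n generalizing e t with
  | zero =>
    have hF : Measurable fun a : ℝ × (E → E) => ∫⁻ u, G e (consSeq a u) ∂(noiseLaw K Λ) :=
      Measurable.lintegral_prod_right'
        (f := fun q : (ℝ × (E → E)) × Noise E => G e (consSeq q.1 q.2))
        (hG.comp (measurable_const.prodMk measurable_consSeq))
    have hstep : ∀ a : ℝ × (E → E), ∫⁻ u, {u | HasJumps 0 t u}.indicator
          (fun u => G (chain 0 e u) (future 0 t u)) (consSeq a u) ∂(noiseLaw K Λ) =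
        (Set.Ioi t).indicator
          (fun s => ∫⁻ u, G e (consSeq (s - t, a.2) u) ∂(noiseLaw K Λ)) a.1 := by
      intro a
      by_cases h : t < a.1
      · rw [Set.indicator_of_mem (Set.mem_Ioi.2 h)]
        refine lintegral_congr fun u => ?_
        rw [Set.indicator_of_mem (by exact h)]
        rfl
      · rw [Set.indicator_of_notMem (by simpa using h), ← lintegral_zero (μ := noiseLaw K Λ)]
        refine lintegral_congr fun u => ?_
        rw [Set.indicator_of_notMem (by exact h)]
    have hF' : Measurable fun a : ℝ × (E → E) => (Set.Ioi t).indicator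
        (fun s => ∫⁻ u, G e (consSeq (s - t, a.2) u) ∂(noiseLaw K Λ)) a.1 := by
      have : Measurable fun a : ℝ × (E → E) =>
          ∫⁻ u, G e (consSeq (a.1 - t, a.2) u) ∂(noiseLaw K Λ) :=
        hF.comp (g := fun a : ℝ × (E → E) => ∫⁻ u, G e (consSeq a u) ∂(noiseLaw K Λ))
          ((measurable_fst.sub_const t).prodMk measurable_snd)
      exact this.indicator (measurable_fst measurableSet_Ioi)
    unfold noiseLaw
    rw [lintegral_infinitePi_cons _ (hm 0 e t)]
    simp only [powLaw, lintegral_dirac]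
    have hGe : Measurable fun u => G e u := hG.comp (measurable_const.prodMk measurable_id)
    rw [lintegral_infinitePi_cons _ hGe]
    change ∫⁻ a, ∫⁻ u, {u | HasJumps 0 t u}.indicator
      (fun u => G (chain 0 e u) (future 0 t u)) (consSeq a u) ∂(noiseLaw K Λ) ∂_ =
      _ * ∫⁻ a, ∫⁻ u, G e (consSeq a u) ∂(noiseLaw K Λ) ∂_
    simp_rw [hstep]
    rw [lintegral_prod_symm _ hF'.aemeasurable, lintegral_prod_symm _ hF.aemeasurable,
      ← lintegral_const_mul' _ _ ENNReal.ofReal_ne_top]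
    refine lintegral_congr fun m => ?_
    rw [lintegral_expMeasure_shift ht
      (F := fun s => ∫⁻ u, G e (consSeq (s, m) u) ∂(noiseLaw K Λ))
      (hF.comp (measurable_id.prodMk measurable_const))]
    simp [poissonWeight]
  | succ n ih =>
    set H : E → ℝ≥0∞ := fun z => ∫⁻ z', ∫⁻ u, G z' u ∂(noiseLaw K Λ) ∂(powLaw K n z) with hH
    have hstep : ∀ a : ℝ × (E → E), ∫⁻ u, {u | HasJumps (n + 1) t u}.indicator
          (fun u => G (chain (n + 1) e u) (future (n + 1) t u)) (consSeq a u) ∂(noiseLaw K Λ) =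
        (Set.Iic t).indicator (fun s => ENNReal.ofReal (poissonWeight Λ (t - s) n)) a.1 *
          H (a.2 e) := by
      intro a
      by_cases h : a.1 ≤ t
      · rw [Set.indicator_of_mem (Set.mem_Iic.2 h), hH, ← ih (sub_nonneg.2 h)]
        refine lintegral_congr fun u => ?_
        by_cases hu : HasJumps n (t - a.1) u
        · rw [Set.indicator_of_mem (by exact ⟨h, hu⟩), Set.indicator_of_mem (by exact hu)]
          rfl
        · rw [Set.indicator_of_notMem (by exact fun h' => hu h'.2),
            Set.indicator_of_notMem (by exact hu)]
      · rw [Set.indicator_of_notMem (by simpa using h), zero_mul,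
          ← lintegral_zero (μ := noiseLaw K Λ)]
        refine lintegral_congr fun u => ?_
        rw [Set.indicator_of_notMem (by exact fun h' => h h'.1)]
    have hw : Measurable fun s =>
        (Set.Iic t).indicator (fun s => ENNReal.ofReal (poissonWeight Λ (t - s) n)) s := by
      have : Measurable fun s => ENNReal.ofReal (poissonWeight Λ (t - s) n) := by
        unfold poissonWeight; fun_prop
      exact this.indicator measurableSet_Iic
    have hHm : Measurable H := Measurable.of_discrete
    conv_lhs => unfold noiseLaw
    rw [lintegral_infinitePi_cons _ (hm (n + 1) e t)]
    change ∫⁻ a, ∫⁻ u, {u | HasJumps (n + 1) t u}.indicator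
      (fun u => G (chain (n + 1) e u) (future (n + 1) t u)) (consSeq a u) ∂(noiseLaw K Λ) ∂_ = _
    simp_rw [hstep]
    rw [lintegral_prod_mul (f := fun s => (Set.Iic t).indicator _ s)
        (g := fun m : E → E => H (m e)) hw.aemeasurable
        (hHm.comp (measurable_pi_apply e)).aemeasurable,
      lintegral_poissonWeight_sub hΛ.out ht,
      (measurePreserving_eval_infinitePi K e).lintegral_comp hHm]
    simp only [powLaw]
    rw [Measure.lintegral_bind Measurable.of_discrete.aemeasurable
      Measurable.of_discrete.aemeasurable]

end Law

/-! ### The Markov property of the constructed process -/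

/-- The clock ticks finitely often in every bounded time interval. -/
def NonExplosive {E : Type*} (u : Noise E) : Prop := ∀ t : ℝ, ∃ n, HasJumps n t u

open Classical in
/-- The state at time `t` of the chain started at `e`. On the null set of explosive clocks the
process is taken to be constant, which keeps all its paths in the Skorohod space. -/
noncomputable def stateAt {E : Type*} (e : E) (u : Noise E) (t : ℝ) : E :=
  if h : NonExplosive u then chain (h t).choose e u else e

/-- The law at time `t` of the process started at `e`: the law of the chain after a Poisson
number of steps. -/
noncomputable def jumpLaw {E : Type*} [MeasurableSpace E] (K : E → Measure E) (Λ t : ℝ) (e : E) :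
    Measure E :=
  Measure.sum fun n => ENNReal.ofReal (poissonWeight Λ t n) • powLaw K n e

section Pathwise

variable {E : Type*}

lemma stateAt_eq {n : ℕ} {t : ℝ} {u : Noise E} (hu : NonExplosive u) (hn : HasJumps n t u)
    (e : E) : stateAt e u t = chain n e u := by
  rw [stateAt, dif_pos hu, HasJumps.unique (hu t).choose_spec hn]

lemma HasJumps.exists_future {n k : ℕ} {t h : ℝ} {u : Noise E} (hh : 0 ≤ h)
    (hn : HasJumps n t u) (hk : HasJumps k (t + h) u) : ∃ m, HasJumps m h (future n t u) := by
  induction n generalizing k t u with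
  | zero =>
    cases k with
    | zero => exact ⟨0, by simp only [HasJumps, future, consSeq] at hk ⊢; linarith⟩
    | succ k =>
      refine ⟨k + 1, ?_⟩
      simp only [HasJumps, future, consSeq] at hk ⊢
      refine ⟨by linarith [hk.1], ?_⟩
      convert hk.2 using 1
      ring
  | succ n ih =>
    cases k with
    | zero =>
      have h1 := hn.1
      simp only [HasJumps] at hk
      linarith
    | succ k =>
      refine ih (k := k) hn.2 ?_
      convert hk.2 using 1
      ring

lemma NonExplosive.future {n : ℕ} {t : ℝ} {u : Noise E} (hu : NonExplosive u)
    (hn : HasJumps n t u) : NonExplosive (future n t u) := by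
  intro h
  obtain ⟨k, hk⟩ := hu (t + max h 0)
  obtain ⟨m, hm⟩ := hn.exists_future (le_max_right h 0) hk
  exact hm.exists_of_le (le_max_left h 0)

lemma stateAt_add {n : ℕ} {t h : ℝ} {u : Noise E} (hh : 0 ≤ h) (hu : NonExplosive u)
    (hn : HasJumps n t u) (e : E) :
    stateAt e u (t + h) = stateAt (chain n e u) (future n t u) h := by
  obtain ⟨m, hm⟩ := hu.future hn h
  rw [stateAt_eq hu (hn.add hh hm), stateAt_eq (hu.future hn) hm, chain_add]

variable {S : Type*} [TopologicalSpace S]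

/-- The path `t ↦ f (X t)` of the process `X` started at `e`. -/
noncomputable def path (f : E → S) (e : E) (u : Noise E) : SkorohodSpace S := by
  refine ⟨fun t => f (stateAt e u t), fun t => ?_, fun t _ => ?_⟩
  · by_cases hu : NonExplosive u
    · obtain ⟨n, hn⟩ := hu t
      obtain ⟨δ, hδ, h⟩ := hn.eventually_right
      refine continuousWithinAt_const.congr_of_eventuallyEq (f := fun _ => f (chain n e u)) ?_
        (congrArg f (stateAt_eq hu hn e))
      have hlt : (t : ℝ) < t + δ := by linarith
      have hmem : ∀ᶠ s : ℝ≥0 in 𝓝[Set.Ici t] t, (s : ℝ) < t + δ :=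
        mem_nhdsWithin_of_mem_nhds ((NNReal.continuous_coe.tendsto t).eventually_lt_const hlt)
      filter_upwards [hmem, self_mem_nhdsWithin] with s hs hst
      exact congrArg f (stateAt_eq hu (h s (NNReal.coe_le_coe.2 hst) hs) e)
    · simp only [stateAt, dif_neg hu]
      exact continuousWithinAt_const
  · by_cases hu : NonExplosive u
    · choose N hN using hu
      have hmono : Monotone fun s : ℝ≥0 => N s := fun s t hst =>
        (hN s).mono (NNReal.coe_le_coe.2 hst) (hN t)
      have hf : (fun s : ℝ≥0 => f (stateAt e u s)) =
          (fun n => f (chain n e u)) ∘ fun s : ℝ≥0 => N s := by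
        funext s
        exact congrArg f (stateAt_eq (fun t => ⟨N t, hN t⟩) (hN s) e)
      rw [hf]
      exact ⟨_, ((continuous_of_discreteTopology (f := fun n => f (chain n e u))).tendsto _).comp
        (hmono.tendsto_nhdsLT t)⟩
    · simp only [stateAt, dif_neg hu]
      exact ⟨_, tendsto_const_nhds⟩

end Pathwise

section Law

variable {E : Type*} [MeasurableSpace E] [DiscreteMeasurableSpace E] [Countable E]
  (K : E → Measure E) [∀ e, IsProbabilityMeasure (K e)] (Λ : ℝ) [hΛ : Fact (0 < Λ)]

omit [Countable E] in
lemma isProbabilityMeasure_jumpLaw {t : ℝ} (ht : 0 ≤ t) (e : E) :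
    IsProbabilityMeasure (jumpLaw K Λ t e) :=
  ⟨by simp [jumpLaw, Measure.sum_apply _ MeasurableSet.univ,
    tsum_ofReal_poissonWeight hΛ.out ht]⟩

omit [DiscreteMeasurableSpace E] [Countable E] in
lemma measurableSet_setOf_hasJumps (n : ℕ) (t : ℝ) :
    MeasurableSet {u : Noise E | HasJumps n t u} :=
  (measurable_const.prodMk measurable_id) (measurableSet_hasJumps n)

omit [DiscreteMeasurableSpace E] [Countable E] in
lemma measurableSet_nonExplosive : MeasurableSet {u : Noise E | NonExplosive u} := by
  have : {u : Noise E | NonExplosive u} = ⋂ k : ℕ, ⋃ n, {u | HasJumps n k u} := by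
    ext u
    simp only [Set.mem_ofPred_eq, Set.mem_iInter, Set.mem_iUnion]
    refine ⟨fun h k => h k, fun h t => ?_⟩
    obtain ⟨k, hk⟩ := exists_nat_ge t
    obtain ⟨n, hn⟩ := h k
    exact hn.exists_of_le hk
  rw [this]
  exact MeasurableSet.iInter fun k => MeasurableSet.iUnion fun n =>
    measurableSet_setOf_hasJumps n k

/-- The clock is almost surely not explosive, since the Poisson weights add up to one. -/
lemma ae_nonExplosive (e : E) : ∀ᵐ u ∂(noiseLaw K Λ), NonExplosive u := by
  have key : ∀ k : ℕ, ∀ᵐ u ∂(noiseLaw K Λ), ∃ n, HasJumps n k u := by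
    intro k
    have hmeas : ∀ n, MeasurableSet {u : Noise E | HasJumps n k u} := fun n =>
      measurableSet_setOf_hasJumps n k
    have hdisj : Pairwise (Function.onFun Disjoint fun n => {u : Noise E | HasJumps n k u}) :=
      fun i j hij => Set.disjoint_left.2 fun u hi hj => hij (HasJumps.unique hi hj)
    have h1 : noiseLaw K Λ (⋃ n, {u : Noise E | HasJumps n k u}) = 1 := by
      rw [measure_iUnion hdisj hmeas, ← tsum_ofReal_poissonWeight hΛ.out k.cast_nonneg]
      refine tsum_congr fun n => ?_
      have := lintegral_hasJumps K Λ n k.cast_nonneg e (G := fun _ _ => 1) measurable_const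
      rw [lintegral_indicator_const (hmeas n)] at this
      simpa using this
    have h2 := (prob_compl_eq_zero_iff (MeasurableSet.iUnion hmeas)).2 h1
    rw [ae_iff]
    convert h2 using 2
    ext u
    simp
  filter_upwards [ae_all_iff.2 key] with u hu t
  obtain ⟨k, hk⟩ := exists_nat_ge t
  obtain ⟨n, hn⟩ := hu k
  exact hn.exists_of_le hk

lemma measurable_stateAt (t : ℝ) : Measurable fun p : E × Noise E => stateAt p.1 p.2 t := by
  refine measurable_to_countable' fun z => ?_
  have : (fun p : E × Noise E => stateAt p.1 p.2 t) ⁻¹' {z} =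
      (⋃ n, {p | NonExplosive p.2} ∩ ({p | HasJumps n t p.2} ∩ {p | chain n p.1 p.2 = z})) ∪
        ({p | NonExplosive p.2}ᶜ ∩ {p | p.1 = z}) := by
    ext ⟨e, u⟩
    by_cases hu : NonExplosive u
    · simp only [Set.mem_preimage, Set.mem_singleton_iff, Set.mem_union, Set.mem_iUnion,
        Set.mem_inter_iff, Set.mem_ofPred_eq, hu, true_and, Set.mem_compl_iff, not_true, false_and,
        or_false]
      refine ⟨fun h => ?_, fun ⟨n, hn, h⟩ => (stateAt_eq hu hn e).trans h⟩
      obtain ⟨n, hn⟩ := hu t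
      exact ⟨n, hn, (stateAt_eq hu hn e).symm.trans h⟩
    · simp [hu, stateAt]
  rw [this]
  have hne : MeasurableSet {p : E × Noise E | NonExplosive p.2} :=
    measurable_snd measurableSet_nonExplosive
  exact (MeasurableSet.iUnion fun n => hne.inter
    ((measurable_snd (measurableSet_setOf_hasJumps n t)).inter
      (measurable_chain n (measurableSet_singleton z)))).union
    (hne.compl.inter (measurable_fst (measurableSet_singleton z)))

/-- The Markov property at time `t`: the noise seen from time `t` is independent of the state at
time `t`, and has the same law as the original noise. -/
lemma noiseLaw_eq_lintegral_jumpLaw {t : ℝ} (ht : 0 ≤ t) (e : E) {A : Set (Noise E)}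
    {B : Set (E × Noise E)} (hB : MeasurableSet B)
    (hAB : ∀ n u, NonExplosive u → HasJumps n t u → (u ∈ A ↔ (chain n e u, future n t u) ∈ B)) :
    noiseLaw K Λ A = ∫⁻ z, noiseLaw K Λ {u | (z, u) ∈ B} ∂(jumpLaw K Λ t e) := by
  set G : E → Noise E → ℝ≥0∞ := fun z u => B.indicator 1 (z, u) with hG
  have hGm : Measurable (Function.uncurry G) := measurable_one.indicator hB
  set C : ℕ → Set (Noise E) := fun n =>
    {u | HasJumps n t u ∧ (chain n e u, future n t u) ∈ B} with hC
  have hCm : ∀ n, MeasurableSet (C n) := fun n => (measurableSet_setOf_hasJumps n t).inter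
    ((((measurable_chain n).comp (measurable_const.prodMk measurable_id)).prodMk
      ((measurable_future n).comp (measurable_const.prodMk measurable_id))) hB)
  have hA : A =ᵐ[noiseLaw K Λ] ⋃ n, C n := by
    filter_upwards [ae_nonExplosive K Λ e] with u hu
    obtain ⟨n, hn⟩ := hu t
    refine propext ((hAB n u hu hn).trans ?_)
    refine ⟨fun h => Set.mem_iUnion.2 ⟨n, hn, h⟩, fun h => ?_⟩
    obtain ⟨m, hm, h⟩ := Set.mem_iUnion.1 h
    rwa [hn.unique hm]
  have hdisj : Pairwise (Function.onFun Disjoint C) := fun i j hij =>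
    Set.disjoint_left.2 fun u hi hj => hij (HasJumps.unique hi.1 hj.1)
  rw [measure_congr hA, measure_iUnion hdisj hCm, jumpLaw, lintegral_sum_measure]
  refine tsum_congr fun n => ?_
  have hI : ∀ z, ∫⁻ u, G z u ∂(noiseLaw K Λ) = noiseLaw K Λ {u | (z, u) ∈ B} := fun z =>
    lintegral_indicator_one (s := {u | (z, u) ∈ B}) (measurable_prodMk_left hB)
  rw [lintegral_smul_measure, smul_eq_mul]
  simp_rw [← hI]
  rw [← lintegral_hasJumps K Λ n ht e hGm, ← lintegral_indicator_one (hCm n)]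
  refine lintegral_congr fun u => ?_
  by_cases h1 : HasJumps n t u <;> by_cases h2 : (chain n e u, future n t u) ∈ B <;>
    simp [hC, hG, h1, h2]

lemma noiseLaw_stateAt {t : ℝ} (ht : 0 ≤ t) (e : E) (s : Set E) :
    noiseLaw K Λ {u | stateAt e u t ∈ s} = jumpLaw K Λ t e s := by
  have hs : MeasurableSet s := MeasurableSet.of_discrete
  rw [noiseLaw_eq_lintegral_jumpLaw K Λ ht e (B := Prod.fst ⁻¹' s) (measurable_fst hs)
    (fun n u hu hn => by simp [stateAt_eq hu hn])]
  rw [← lintegral_indicator_one hs]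
  refine lintegral_congr fun z => ?_
  by_cases hz : z ∈ s <;> simp [hz]

/-- The Chapman–Kolmogorov equation. -/
lemma jumpLaw_add {s t : ℝ} (hs : 0 ≤ s) (ht : 0 ≤ t) (e : E) (A : Set E) :
    jumpLaw K Λ (s + t) e A = ∫⁻ z, jumpLaw K Λ t z A ∂(jumpLaw K Λ s e) := by
  have hA : MeasurableSet A := MeasurableSet.of_discrete
  rw [← noiseLaw_stateAt K Λ (add_nonneg hs ht), noiseLaw_eq_lintegral_jumpLaw K Λ hs e
    (B := {p | stateAt p.1 p.2 t ∈ A}) (measurable_stateAt t hA)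
    (fun n u hu hn => by simp [stateAt_add ht hu hn])]
  exact lintegral_congr fun z => noiseLaw_stateAt K Λ ht z A

omit [∀ e, IsProbabilityMeasure (K e)] hΛ in
/-- If the steps of a chain on `E` project under `f` to steps of a chain on `S`, so do the laws at
time `t`. -/
lemma map_jumpLaw {S : Type*} [MeasurableSpace S] [DiscreteMeasurableSpace S] [Countable S]
    {f : E → S} {P : S → Measure S} (hf : ∀ e, (K e).map f = P (f e)) (t : ℝ) (e : E) :
    (jumpLaw K Λ t e).map f = jumpLaw P Λ t (f e) := by
  have hfm : Measurable f := Measurable.of_discrete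
  have hpow : ∀ n e, (powLaw K n e).map f = powLaw P n (f e) := by
    intro n
    induction n with
    | zero => intro e; simp [powLaw, Measure.map_dirac]
    | succ n ih =>
      intro e
      ext s hs
      rw [Measure.map_apply hfm hs]
      simp only [powLaw]
      rw [Measure.bind_apply (hfm hs) Measurable.of_discrete.aemeasurable,
        Measure.bind_apply hs Measurable.of_discrete.aemeasurable, ← hf,
        lintegral_map (Measurable.of_discrete (f := fun z => powLaw P n z s)) hfm]
      exact lintegral_congr fun z => by rw [← ih, Measure.map_apply hfm hs]
  ext s hs
  rw [Measure.map_apply hfm hs, jumpLaw, jumpLaw, Measure.sum_apply _ (hfm hs),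
    Measure.sum_apply _ hs]
  refine tsum_congr fun n => ?_
  rw [Measure.smul_apply, Measure.smul_apply, ← hpow, Measure.map_apply hfm hs]

/-- The finite-dimensional Markov property of the projection `f (X t)` of the process, when the
steps of the chain project under `f` to steps of a chain on `S`. -/
lemma noiseLaw_markov {S : Type*} [MeasurableSpace S] [DiscreteMeasurableSpace S] [Countable S]
    {f : E → S} {P : S → Measure S} (hf : ∀ e, (K e).map f = P (f e)) (n : ℕ)
    (t : Fin (n + 1) → ℝ≥0) (x : Fin (n + 1) → S) (ht : Monotone t) (h : ℝ≥0) (y : S) (e : E) :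
    noiseLaw K Λ {u | (∀ j, f (stateAt e u (t j)) = x j) ∧
        f (stateAt e u (t (Fin.last n) + h)) = y} =
      noiseLaw K Λ {u | ∀ j, f (stateAt e u (t j)) = x j} *
        jumpLaw P Λ h (x (Fin.last n)) {y} := by
  have hms : ∀ (s : ℝ) (a : S), MeasurableSet {p : E × Noise E | f (stateAt p.1 p.2 s) = a} :=
    fun s a => measurable_stateAt s (MeasurableSet.of_discrete (s := f ⁻¹' {a}))
  have hmf : ∀ a : S, MeasurableSet {p : E × Noise E | f p.1 = a} :=
    fun a => measurable_fst (MeasurableSet.of_discrete (s := f ⁻¹' {a}))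
  have hlaw : ∀ z, noiseLaw K Λ {u | f (stateAt z u h) = y} = jumpLaw P Λ h (f z) {y} := by
    intro z
    rw [← map_jumpLaw K Λ hf, Measure.map_apply Measurable.of_discrete (measurableSet_singleton y)]
    exact noiseLaw_stateAt K Λ h.2 z (f ⁻¹' {y})
  induction n generalizing e with
  | zero =>
    rw [noiseLaw_eq_lintegral_jumpLaw K Λ (t 0).coe_nonneg e
        (B := {p | f p.1 = x 0} ∩ {p | f (stateAt p.1 p.2 h) = y}) ((hmf _).inter (hms _ _))
        (fun n u hu hn => by
          simp [Fin.forall_fin_one, stateAt_add h.coe_nonneg hu hn, stateAt_eq hu hn]),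
      noiseLaw_eq_lintegral_jumpLaw K Λ (t 0).coe_nonneg e (B := {p | f p.1 = x 0}) (hmf _)
        (fun n u hu hn => by simp [Fin.forall_fin_one, stateAt_eq hu hn]),
      ← lintegral_mul_const _ Measurable.of_discrete]
    refine lintegral_congr fun z => ?_
    by_cases hz : f z = x 0
    · simp [hz, hlaw]
    · simp [hz]
  | succ n ih =>
    have h0 : ∀ j, t 0 ≤ t j := fun j => ht (Fin.zero_le j)
    have hadd : ∀ j, (t j : ℝ) = (t 0 : ℝ) + ((t j - t 0 : ℝ≥0) : ℝ) := fun j => by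
      rw [NNReal.coe_sub (h0 j)]; ring
    have hsucc : ∀ (m : ℕ) (u : Noise E), NonExplosive u → HasJumps m (t 0) u →
        ((∀ j, f (stateAt e u (t j)) = x j) ↔ f (chain m e u) = x 0 ∧
          ∀ j : Fin (n + 1), f (stateAt (chain m e u) (future m (t 0) u)
            ((t j.succ - t 0 : ℝ≥0) : ℝ)) = x j.succ) := by
      intro m u hu hm
      rw [Fin.forall_fin_succ, stateAt_eq hu hm]
      refine and_congr_right fun _ => forall_congr' fun j => ?_
      rw [hadd j.succ, stateAt_add (t j.succ - t 0).coe_nonneg hu hm]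
    have hmono : Monotone fun j : Fin (n + 1) => t j.succ - t 0 := fun i j hij =>
      tsub_le_tsub_right (ht (Fin.succ_le_succ_iff.2 hij)) _
    have hmB : MeasurableSet {p : E × Noise E | f p.1 = x 0 ∧
        ∀ j : Fin (n + 1), f (stateAt p.1 p.2 ((t j.succ - t 0 : ℝ≥0) : ℝ)) = x j.succ} :=
      (hmf (x 0)).inter (measurableSet_setOfPred.2
        (Measurable.forall fun j => measurableSet_setOfPred.1 (hms _ _)))
    rw [noiseLaw_eq_lintegral_jumpLaw K Λ (t 0).coe_nonneg e
        (B := {p | f p.1 = x 0 ∧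
          ∀ j : Fin (n + 1), f (stateAt p.1 p.2 ((t j.succ - t 0 : ℝ≥0) : ℝ)) = x j.succ} ∩
          {p | f (stateAt p.1 p.2 (((t (Fin.last n).succ - t 0 : ℝ≥0) : ℝ) + h)) = y})
        (hmB.inter (hms _ _))
        (fun m u hu hm => by
          refine and_congr (hsucc m u hu hm) ?_
          rw [← Fin.succ_last, hadd (Fin.last n).succ, add_assoc, stateAt_add (by positivity) hu hm]
          rfl),
      noiseLaw_eq_lintegral_jumpLaw K Λ (t 0).coe_nonneg e
        (A := {u | ∀ j, f (stateAt e u (t j)) = x j}) hmB hsucc,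
      ← lintegral_mul_const _ Measurable.of_discrete]
    refine lintegral_congr fun z => ?_
    by_cases hz : f z = x 0
    · have := ih _ (fun j => x j.succ) hmono z
      simpa [hz] using this
    · simp [hz]

end Law

/-! ### Uniqueness of the transition function -/

lemma abs_tsum_le {ι : Type*} {f g : ι → ℝ} (h : ∀ i, |f i| ≤ g i) (hg : Summable g) :
    |∑' i, f i| ≤ ∑' i, g i :=
  by simpa only [Real.norm_eq_abs] using tsum_of_norm_bounded (f := f) hg.hasSum h

namespace IsTransitionFunction

variable {E : Type*} {p r : ℝ≥0 → E → E → ℝ}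

lemma le_one (hp : IsTransitionFunction p) (t : ℝ≥0) (x y : E) : p t x y ≤ 1 :=
  le_hasSum (hp.hasSum_one t x) y fun _ _ => hp.nonneg _ _ _

lemma mul_le_add (hp : IsTransitionFunction p) (s t : ℝ≥0) (x : E) :
    p s x x * p t x x ≤ p (s + t) x x :=
  le_hasSum (hp.chapman_kolmogorov s t x x) x fun _ _ =>
    mul_nonneg (hp.nonneg _ _ _) (hp.nonneg _ _ _)

lemma pow_le_nsmul (hp : IsTransitionFunction p) (h : ℝ≥0) (x : E) (n : ℕ) :
    p h x x ^ n ≤ p (n • h) x x := by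
  induction n with
  | zero => simp [hp.zero]
  | succ n ih =>
    rw [pow_succ, succ_nsmul]
    exact (mul_le_mul_of_nonneg_right ih (hp.nonneg _ _ _)).trans (hp.mul_le_add _ _ _)

/-- The probability of being back at `x` stays above its tangent at time `0`, by
supermultiplicativity and Bernoulli's inequality. -/
lemma one_add_mul_le (hp : IsTransitionFunction p) {x : E} {q : ℝ}
    (hq : Tendsto (fun h : ℝ≥0 => (p h x x - p 0 x x) / (h : ℝ)) (𝓝[>] 0) (𝓝 q)) (t : ℝ≥0) :
    1 + q * t ≤ p t x x := by
  have h0 : p 0 x x = 1 := by simp [hp.zero]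
  rcases eq_or_ne t 0 with rfl | ht
  · simp [h0]
  have htpos : 0 < t := pos_iff_ne_zero.2 ht
  have hlim : Tendsto (fun n : ℕ => t / ((n : ℝ≥0) + 1)) atTop (𝓝[>] 0) := by
    refine tendsto_nhdsWithin_iff.2 ⟨?_, Eventually.of_forall fun n => ?_⟩
    · rw [← NNReal.tendsto_coe]
      have := tendsto_one_div_add_atTop_nhds_zero_nat.const_mul (t : ℝ)
      simpa [div_eq_mul_inv] using this
    · exact Set.mem_Ioi.2 (by positivity)
  have h1 : Tendsto (fun n : ℕ => 1 + (p (t / ((n : ℝ≥0) + 1)) x x - p 0 x x) /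
      ((t / ((n : ℝ≥0) + 1) : ℝ≥0) : ℝ) * t) atTop (𝓝 (1 + q * t)) :=
    ((hq.comp hlim).mul_const _).const_add _
  refine le_of_tendsto' h1 fun n => ?_
  set a := p (t / ((n : ℝ≥0) + 1)) x x - 1 with ha
  have hB := one_add_mul_le_pow (a := a) (by have := hp.nonneg (t / ((n : ℝ≥0) + 1)) x x; linarith)
    (n + 1)
  have ha' : 1 + a = p (t / ((n : ℝ≥0) + 1)) x x := by ring
  have hpow := hp.pow_le_nsmul (t / ((n : ℝ≥0) + 1)) x (n + 1)
  have hnt : (n + 1) • (t / ((n : ℝ≥0) + 1)) = t := by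
    rw [nsmul_eq_mul]; push_cast; field_simp
  rw [hnt] at hpow
  rw [ha'] at hB
  refine le_trans (le_of_eq ?_) (hB.trans hpow)
  rw [h0]
  push_cast
  have : (t : ℝ) ≠ 0 := by exact_mod_cast ht
  field_simp
  rw [ha]
  ring

open Classical in
lemma hasSum_abs_sub_zero (hp : IsTransitionFunction p) (h : ℝ≥0) (x : E) :
    HasSum (fun y => |p h x y - p 0 x y|) (2 * (1 - p h x x)) := by
  have h1 : HasSum (fun y => p h x y + if y = x then 1 - 2 * p h x x else 0)
      (1 + (1 - 2 * p h x x)) := (hp.hasSum_one h x).add (hasSum_ite_eq x _)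
  have h2 : (fun y => |p h x y - p 0 x y|) =
      fun y => p h x y + if y = x then 1 - 2 * p h x x else 0 := by
    funext y
    by_cases hy : y = x
    · subst hy
      have := hp.le_one h y y
      simp only [hp.zero, if_true]
      rw [abs_of_nonpos (by linarith)]
      ring
    · simp [hp.zero, hy, Ne.symm hy, abs_of_nonneg (hp.nonneg h x y)]
  rw [h2]
  convert h1 using 1
  ring

lemma summable_abs_sub (hp : IsTransitionFunction p) (hr : IsTransitionFunction r) (h : ℝ≥0)
    (x : E) : Summable fun y => |p h x y - r h x y| :=
  ((hp.hasSum_one h x).summable.sub (hr.hasSum_one h x).summable).abs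

lemma tsum_abs_sub_nonneg (h : ℝ≥0) (x : E) : 0 ≤ ∑' y, |p h x y - r h x y| :=
  tsum_nonneg fun _ => abs_nonneg _

lemma tsum_abs_sub_le (hp : IsTransitionFunction p) (hr : IsTransitionFunction r) {x : E} {q : ℝ}
    (hpq : Tendsto (fun h : ℝ≥0 => (p h x x - p 0 x x) / (h : ℝ)) (𝓝[>] 0) (𝓝 q))
    (hrq : Tendsto (fun h : ℝ≥0 => (r h x x - r 0 x x) / (h : ℝ)) (𝓝[>] 0) (𝓝 q)) (h : ℝ≥0) :
    ∑' y, |p h x y - r h x y| ≤ 4 * (-q) * h := by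
  have h1 := (hp.hasSum_abs_sub_zero h x).add (hr.hasSum_abs_sub_zero h x)
  have h2 := hp.one_add_mul_le hpq h
  have h3 := hr.one_add_mul_le hrq h
  refine (((hp.summable_abs_sub hr h x).tsum_le_tsum (fun y => ?_) h1.summable).trans
    h1.tsum_eq.le).trans (by linarith)
  have h4 : r 0 x y = p 0 x y := by rw [hp.zero, hr.zero]
  rw [h4, abs_sub_comm (r h x y)]
  exact abs_sub_le _ _ _

/-- If `q` is conservative with finitely many nonzero entries in each row, the total variation
distance of two transition functions with generator `q` is `o(h)`. -/
lemma tendsto_tsum_abs_sub (hp : IsTransitionFunction p) (hr : IsTransitionFunction r) {x : E}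
    {q : E → ℝ} {F : Finset E} (hF : ∑ y ∈ F, q y = 0) (hx : x ∈ F)
    (hpq : ∀ y, Tendsto (fun h : ℝ≥0 => (p h x y - p 0 x y) / (h : ℝ)) (𝓝[>] 0) (𝓝 (q y)))
    (hrq : ∀ y, Tendsto (fun h : ℝ≥0 => (r h x y - r 0 x y) / (h : ℝ)) (𝓝[>] 0) (𝓝 (q y))) :
    Tendsto (fun h : ℝ≥0 => (∑' y, |p h x y - r h x y|) / (h : ℝ)) (𝓝[>] 0) (𝓝 0) := by
  classical
  have hle : ∀ h, ∑' y, |p h x y - r h x y| ≤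
      ∑ y ∈ F, |p h x y - r h x y| + ((1 - ∑ y ∈ F, p h x y) + (1 - ∑ y ∈ F, r h x y)) := by
    intro h
    have hsplit : ∀ {p : ℝ≥0 → E → E → ℝ}, IsTransitionFunction p →
        ∑' y : {y // y ∉ F}, p h x y = 1 - ∑ y ∈ F, p h x y := fun {p} hp => by
      rw [← (hp.hasSum_one h x).tsum_eq, ← (hp.hasSum_one h x).summable.sum_add_tsum_compl (s := F)]
      simp only [add_sub_cancel_left]
      rfl
    rw [← (hp.summable_abs_sub hr h x).sum_add_tsum_compl (s := F), ← hsplit hp, ← hsplit hr]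
    gcongr
    have s1 := (hp.hasSum_one h x).summable.subtype {y | y ∉ F}
    have s2 := (hr.hasSum_one h x).summable.subtype {y | y ∉ F}
    have s3 := (hp.summable_abs_sub hr h x).subtype {y | y ∉ F}
    refine le_trans (s3.tsum_le_tsum (fun y => ?_) (s1.add s2)) (s1.tsum_add s2).le
    refine (abs_sub _ _).trans (le_of_eq ?_)
    simp [abs_of_nonneg (hp.nonneg h x y), abs_of_nonneg (hr.nonneg h x y)]
  have hzero : ∀ {p : ℝ≥0 → E → E → ℝ}, IsTransitionFunction p → ∑ y ∈ F, p 0 x y = 1 :=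
    fun {p} hp => by simp [hp.zero, hx]
  have hlim : Tendsto (fun h : ℝ≥0 =>
      ∑ y ∈ F, |(p h x y - p 0 x y) / (h : ℝ) - (r h x y - r 0 x y) / (h : ℝ)| +
        (-(∑ y ∈ F, (p h x y - p 0 x y) / (h : ℝ)) + -(∑ y ∈ F, (r h x y - r 0 x y) / (h : ℝ))))
      (𝓝[>] 0) (𝓝 (∑ y ∈ F, |q y - q y| + (-(∑ y ∈ F, q y) + -(∑ y ∈ F, q y)))) :=
    (tendsto_finsetSum _ fun y _ => ((hpq y).sub (hrq y)).abs).add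
      ((tendsto_finsetSum _ fun y _ => hpq y).neg.add (tendsto_finsetSum _ fun y _ => hrq y).neg)
  simp only [sub_self, abs_zero, Finset.sum_const_zero, hF, neg_zero, add_zero] at hlim
  refine squeeze_zero' (Eventually.of_forall fun h => div_nonneg (tsum_abs_sub_nonneg h x) h.2) ?_
    hlim
  filter_upwards [self_mem_nhdsWithin] with h hh
  have hh' : (0 : ℝ) < h := hh
  refine (div_le_div_of_nonneg_right (hle h) hh'.le).trans (le_of_eq ?_)
  have e1 : ∀ y, r 0 x y = p 0 x y := fun y => by rw [hp.zero, hr.zero]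
  have e2 : ∀ y, |(p h x y - p 0 x y) / (h : ℝ) - (r h x y - r 0 x y) / (h : ℝ)| =
      |p h x y - r h x y| / h := fun y => by
    rw [e1, ← sub_div, abs_div, abs_of_pos hh']; ring_nf
  simp_rw [e2]
  simp_rw [← Finset.sum_div, Finset.sum_sub_distrib]
  rw [hzero hp, hzero hr]
  ring

/-- Comparison of `p_{s+h} r_v` and `p_s r_{h+v}`. -/
lemma abs_tsum_sub_tsum_le (hp : IsTransitionFunction p) (hr : IsTransitionFunction r)
    (s h v : ℝ≥0) (x y : E)
    (hD : Summable fun z => p s x z * ∑' w, |p h z w - r h z w|) :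
    |∑' z, p (s + h) x z * r v z y - ∑' z, p s x z * r (h + v) z y| ≤
      ∑' z, p s x z * ∑' w, |p h z w - r h z w| := by
  have hsum : ∀ {m : ℝ≥0 → E → E → ℝ}, IsTransitionFunction m → ∀ z,
      Summable fun w => m h z w * r v w y := fun {m} hm z =>
    Summable.of_nonneg_of_le (fun w => mul_nonneg (hm.nonneg _ _ _) (hr.nonneg _ _ _))
      (fun w => mul_le_of_le_one_right (hm.nonneg _ _ _) (hr.le_one _ _ _))
      (hm.hasSum_one h z).summable
  -- The double series of the three-fold products converges absolutely.
  have hnn : ∀ z w, 0 ≤ p s x z * (p h z w * r v w y) := fun z w =>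
    mul_nonneg (hp.nonneg _ _ _) (mul_nonneg (hp.nonneg _ _ _) (hr.nonneg _ _ _))
  have hrow : ∀ z, ∑' w, p s x z * (p h z w * r v w y) ≤ p s x z := fun z => by
    rw [tsum_mul_left]
    refine mul_le_of_le_one_right (hp.nonneg _ _ _) ?_
    refine ((hsum hp z).tsum_le_tsum (fun w => ?_) (hp.hasSum_one h z).summable).trans
      (hp.hasSum_one h z).tsum_eq.le
    exact mul_le_of_le_one_right (hp.nonneg _ _ _) (hr.le_one _ _ _)
  have hprod' : Summable fun q : E × E => p s x q.1 * (p h q.1 q.2 * r v q.2 y) :=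
    (summable_prod_of_nonneg (f := fun q : E × E => p s x q.1 * (p h q.1 q.2 * r v q.2 y))
      (fun q => hnn q.1 q.2)).2 ⟨fun z => (hsum hp z).mul_left (p s x z),
        Summable.of_nonneg_of_le (fun z => tsum_nonneg (hnn z)) hrow (hp.hasSum_one s x).summable⟩
  have hprod : Summable (Function.uncurry fun z w => p s x z * (p h z w * r v w y)) := hprod'
  have e1 : ∑' w, p (s + h) x w * r v w y = ∑' z, p s x z * ∑' w, p h z w * r v w y := by
    have : ∀ w, p (s + h) x w * r v w y = ∑' z, p s x z * (p h z w * r v w y) := fun w => by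
      rw [← (hp.chapman_kolmogorov s h x w).tsum_eq, ← tsum_mul_right]
      exact tsum_congr fun z => by ring
    simp_rw [this]
    rw [hprod.tsum_comm]
    exact tsum_congr fun z => tsum_mul_left
  have e2 : ∑' z, p s x z * r (h + v) z y = ∑' z, p s x z * ∑' w, r h z w * r v w y :=
    tsum_congr fun z => by rw [(hr.chapman_kolmogorov h v z y).tsum_eq]
  have hs1 : ∀ {m : ℝ≥0 → E → E → ℝ}, IsTransitionFunction m →
      Summable fun z => p s x z * ∑' w, m h z w * r v w y := fun {m} hm => by
    refine Summable.of_nonneg_of_le (fun z => mul_nonneg (hp.nonneg _ _ _) (tsum_nonneg fun w =>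
      mul_nonneg (hm.nonneg _ _ _) (hr.nonneg _ _ _))) (fun z => ?_) (hp.hasSum_one s x).summable
    refine mul_le_of_le_one_right (hp.nonneg _ _ _) ?_
    refine ((hsum hm z).tsum_le_tsum (fun w => ?_) (hm.hasSum_one h z).summable).trans
      (hm.hasSum_one h z).tsum_eq.le
    exact mul_le_of_le_one_right (hm.nonneg _ _ _) (hr.le_one _ _ _)
  have hterm : ∀ z, |p s x z * ∑' w, p h z w * r v w y - p s x z * ∑' w, r h z w * r v w y| ≤
      p s x z * ∑' w, |p h z w - r h z w| := by
    intro z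
    rw [← mul_sub, abs_mul, abs_of_nonneg (hp.nonneg _ _ _)]
    refine mul_le_mul_of_nonneg_left ?_ (hp.nonneg _ _ _)
    rw [← (hsum hp z).tsum_sub (hsum hr z)]
    have hle : ∀ w, |p h z w * r v w y - r h z w * r v w y| ≤ |p h z w - r h z w| := fun w => by
      rw [← sub_mul, abs_mul, abs_of_nonneg (hr.nonneg _ _ _)]
      exact mul_le_of_le_one_right (abs_nonneg _) (hr.le_one _ _ _)
    exact abs_tsum_le hle (hp.summable_abs_sub hr h z)
  rw [e1, e2, ← (hs1 hp).tsum_sub (hs1 hr)]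
  exact abs_tsum_le hterm hD

/-- A bounded conservative generator with finitely many nonzero entries in each row determines the
transition function. Indeed `s ↦ p_s r_{t-s}` has right derivative `p_s (q - q) r_{t-s} = 0`, and
it interpolates between `r_t` and `p_t`. -/
theorem eq_of_generator (hp : IsTransitionFunction p) (hr : IsTransitionFunction r)
    {q : E → E → ℝ} {F : E → Finset E} (hF : ∀ x, ∑ y ∈ F x, q x y = 0) (hx : ∀ x, x ∈ F x)
    {C : ℝ} (hC : ∀ x, -q x x ≤ C)
    (hpq : ∀ x y, Tendsto (fun h : ℝ≥0 => (p h x y - p 0 x y) / (h : ℝ)) (𝓝[>] 0) (𝓝 (q x y)))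
    (hrq : ∀ x y, Tendsto (fun h : ℝ≥0 => (r h x y - r 0 x y) / (h : ℝ)) (𝓝[>] 0) (𝓝 (q x y))) :
    p = r := by
  have hCD : ∀ (h : ℝ≥0) z, ∑' w, |p h z w - r h z w| ≤ 4 * C * h := fun h z =>
    (hp.tsum_abs_sub_le hr (hpq z z) (hrq z z) h).trans
      (mul_le_mul_of_nonneg_right (by linarith [hC z]) h.coe_nonneg)
  have hbound : ∀ (s h : ℝ≥0) x z, p s x z * ∑' w, |p h z w - r h z w| ≤ p s x z * (4 * C * h) :=
    fun s h x z => mul_le_mul_of_nonneg_left (hCD h z) (hp.nonneg _ _ _)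
  have hW : ∀ (s h : ℝ≥0) x, Summable fun z => p s x z * ∑' w, |p h z w - r h z w| :=
    fun s h x => Summable.of_nonneg_of_le
      (fun z => mul_nonneg (hp.nonneg _ _ _) (tsum_abs_sub_nonneg h z)) (hbound s h x)
      ((hp.hasSum_one s x).summable.mul_right _)
  have hWle : ∀ (s h : ℝ≥0) x, ∑' z, p s x z * ∑' w, |p h z w - r h z w| ≤ 4 * C * h := by
    intro s h x
    refine ((hW s h x).tsum_le_tsum (hbound s h x) ((hp.hasSum_one s x).summable.mul_right _)).trans
      (le_of_eq ?_)
    rw [tsum_mul_right, (hp.hasSum_one s x).tsum_eq, one_mul]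
  have hWlim : ∀ (s : ℝ≥0) x, Tendsto (fun h : ℝ≥0 =>
      (∑' z, p s x z * ∑' w, |p h z w - r h z w|) / (h : ℝ)) (𝓝[>] 0) (𝓝 0) := by
    intro s x
    have h1 : Tendsto (fun h : ℝ≥0 => ∑' z, p s x z * ((∑' w, |p h z w - r h z w|) / (h : ℝ)))
        (𝓝[>] 0) (𝓝 (∑' z, p s x z * 0)) := by
      refine tendsto_tsum_of_dominated_convergence (bound := fun z => p s x z * (4 * C))
        ((hp.hasSum_one s x).summable.mul_right _)
        (fun z => (hp.tendsto_tsum_abs_sub hr (hF z) (hx z) (hpq z) (hrq z)).const_mul _) ?_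
      filter_upwards [self_mem_nhdsWithin] with h hh z
      have hh' : (0 : ℝ) < h := hh
      rw [Real.norm_eq_abs, abs_of_nonneg (mul_nonneg (hp.nonneg _ _ _)
        (div_nonneg (tsum_abs_sub_nonneg h z) hh'.le))]
      refine mul_le_mul_of_nonneg_left ?_ (hp.nonneg _ _ _)
      rw [div_le_iff₀ hh']
      exact hCD h z
    simp only [mul_zero, tsum_zero] at h1
    refine h1.congr fun h => ?_
    rw [← tsum_div_const]
    exact tsum_congr fun z => by ring
  funext t x y
  set Φ : ℝ → ℝ := fun s => ∑' z, p s.toNNReal x z * r (t - s.toNNReal) z y with hΦ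
  have hdiff : ∀ s s' : ℝ, 0 ≤ s → s ≤ s' → s' ≤ t → |Φ s' - Φ s| ≤
      ∑' z, p s.toNNReal x z * ∑' w, |p (s' - s).toNNReal z w - r (s' - s).toNNReal z w| := by
    intro s s' h0 h1 h2
    have e1 : s'.toNNReal = s.toNNReal + (s' - s).toNNReal := by
      rw [← Real.toNNReal_add h0 (sub_nonneg.2 h1)]; congr 1; ring
    have e2 : t - s.toNNReal = (s' - s).toNNReal + (t - s'.toNNReal) := by
      rw [e1, ← tsub_tsub, add_tsub_cancel_of_le]
      rw [le_tsub_iff_left (Real.toNNReal_le_iff_le_coe.2 (h1.trans h2)), ← e1]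
      exact Real.toNNReal_le_iff_le_coe.2 h2
    have h3 := hp.abs_tsum_sub_tsum_le hr s.toNNReal (s' - s).toNNReal (t - s'.toNNReal) x y
      (hW _ _ _)
    rwa [← e1, ← e2] at h3
  have hLip : ∀ s s' : ℝ, 0 ≤ s → s ≤ s' → s' ≤ t → |Φ s' - Φ s| ≤ 4 * C * |s' - s| := by
    intro s s' h0 h1 h2
    refine (hdiff s s' h0 h1 h2).trans ((hWle _ _ _).trans (le_of_eq ?_))
    rw [Real.coe_toNNReal _ (sub_nonneg.2 h1), abs_of_nonneg (sub_nonneg.2 h1)]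
  have hC0 : 0 ≤ C := by
    have h1 := (tsum_abs_sub_nonneg (p := p) (r := r) 1 x).trans (hCD 1 x)
    simp only [NNReal.coe_one] at h1
    linarith
  have hcont : ContinuousOn Φ (Set.Icc 0 t) := by
    refine (LipschitzOnWith.of_dist_le_mul (K := (4 * C).toNNReal) fun a ha b hb => ?_).continuousOn
    rw [Real.dist_eq, Real.dist_eq, Real.coe_toNNReal _ (by linarith)]
    rcases le_total a b with h | h
    · rw [abs_sub_comm, abs_sub_comm a]
      exact hLip a b ha.1 h hb.2
    · exact hLip b a hb.1 h ha.2
  have hderiv : ∀ s ∈ Set.Ico (0 : ℝ) t, HasDerivWithinAt Φ 0 (Set.Ici s) s := by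
    intro s hs
    rw [← hasDerivWithinAt_Ioi_iff_Ici, hasDerivWithinAt_iff_tendsto_slope' Set.self_notMem_Ioi]
    have hcomp : Tendsto (fun s' : ℝ => (s' - s).toNNReal) (𝓝[>] s) (𝓝[>] 0) := by
      refine tendsto_nhdsWithin_iff.2 ⟨?_, ?_⟩
      · have : Tendsto (fun s' : ℝ => (s' - s).toNNReal) (𝓝 s) (𝓝 (s - s).toNNReal) :=
          (continuous_real_toNNReal.comp (continuous_id.sub continuous_const)).tendsto s
        rw [sub_self, Real.toNNReal_zero] at this
        exact this.mono_left nhdsWithin_le_nhds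
      · filter_upwards [self_mem_nhdsWithin] with s' hs'
        exact Real.toNNReal_pos.2 (sub_pos.2 hs')
    refine squeeze_zero_norm' ?_ ((hWlim s.toNNReal x).comp hcomp)
    filter_upwards [self_mem_nhdsWithin, mem_nhdsWithin_of_mem_nhds (Iio_mem_nhds hs.2)]
      with s' h1 h2
    have h3 : 0 < s' - s := sub_pos.2 h1
    rw [slope_def_field, Real.norm_eq_abs, abs_div, abs_of_pos h3, Function.comp_apply,
      Real.coe_toNNReal _ h3.le]
    exact div_le_div_of_nonneg_right (hdiff s s' hs.1 (le_of_lt h1) (le_of_lt h2)) h3.le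
  have hconst := constant_of_has_deriv_right_zero hcont hderiv t ⟨t.coe_nonneg, le_rfl⟩
  have hΦ0 : Φ 0 = r t x y := by
    simp [hΦ, hp.zero]
  have hΦt : Φ t = p t x y := by
    simp [hΦ, hr.zero]
  rw [← hΦ0, ← hΦt, hconst]

end IsTransitionFunction

/-! ### The transition function of the constructed process -/

lemma tendsto_coe_nhdsGT_zero : Tendsto (fun h : ℝ≥0 => (h : ℝ)) (𝓝[>] 0) (𝓝[>] 0) := by
  refine tendsto_nhdsWithin_iff.2 ⟨?_, ?_⟩
  · have : Tendsto (fun h : ℝ≥0 => (h : ℝ)) (𝓝 0) (𝓝 ((0 : ℝ≥0) : ℝ)) :=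
      NNReal.continuous_coe.tendsto 0
    exact this.mono_left nhdsWithin_le_nhds
  · filter_upwards [self_mem_nhdsWithin] with h hh
    exact NNReal.coe_pos.2 hh

section Transition

variable {S : Type*} [MeasurableSpace S] [DiscreteMeasurableSpace S] [Countable S]
  (P : S → Measure S) [∀ x, IsProbabilityMeasure (P x)] (Λ : ℝ) [hΛ : Fact (0 < Λ)]

omit [∀ x, IsProbabilityMeasure (P x)] hΛ in
lemma jumpLaw_zero (x : S) : jumpLaw P Λ 0 x = Measure.dirac x := by
  ext s hs
  rw [jumpLaw, Measure.sum_apply _ hs, tsum_eq_single 0]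
  · simp [poissonWeight, powLaw]
  · intro n hn
    simp [poissonWeight, hn]

lemma isTransitionFunction_jumpLaw :
    IsTransitionFunction fun (t : ℝ≥0) x y => (jumpLaw P Λ t x).real {y} := by
  have hprob : ∀ (t : ℝ≥0) x, IsProbabilityMeasure (jumpLaw P Λ t x) := fun t x =>
    isProbabilityMeasure_jumpLaw P Λ t.coe_nonneg x
  refine ⟨fun t x y => measureReal_nonneg, fun t x => ?_, fun x y => ?_, fun s t x y => ?_⟩
  · have h1 : ∑' y, jumpLaw P Λ t x {y} = 1 := by
      have := lintegral_countable' (μ := jumpLaw P Λ t x) (fun _ => 1)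
      simpa using this.symm
    have h2 := ENNReal.hasSum_toReal (f := fun y => jumpLaw P Λ t x {y})
      (by rw [h1]; exact ENNReal.one_ne_top)
    rwa [← ENNReal.tsum_toReal_eq (fun y => measure_ne_top _ _), h1, ENNReal.toReal_one] at h2
  · rw [NNReal.coe_zero, jumpLaw_zero, measureReal_def, Measure.dirac_apply]
    by_cases h : x = y <;> simp [h]
  · have h1 := jumpLaw_add P Λ s.coe_nonneg t.coe_nonneg x {y}
    rw [lintegral_countable'] at h1
    have hne : ∑' z, jumpLaw P Λ t z {y} * jumpLaw P Λ s x {z} ≠ ∞ := by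
      rw [← h1, ← NNReal.coe_add]; exact measure_ne_top _ _
    have h2 := ENNReal.hasSum_toReal hne
    rw [← ENNReal.tsum_toReal_eq (fun z => ENNReal.mul_ne_top (measure_ne_top _ _)
      (measure_ne_top _ _)), ← h1] at h2
    simp only [measureReal_def, NNReal.coe_add]
    convert! h2 using 1
    funext z
    rw [ENNReal.toReal_mul, mul_comm]

/-- The generator of the process is `Λ (P - 1)`: up to `o(h)`, the clock ticks at most once in a
time interval of length `h`. -/
lemma tendsto_jumpLaw_sub_div (x y : S) :
    Tendsto (fun h : ℝ≥0 => ((jumpLaw P Λ h x).real {y} -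
      (jumpLaw P Λ (0 : ℝ≥0) x).real {y}) / (h : ℝ)) (𝓝[>] 0)
      (𝓝 (Λ * ((P x).real {y} - (Measure.dirac x).real {y}))) := by
  set d := (Measure.dirac x).real {y} with hd
  set a := (P x).real {y} with ha
  have hpow1 : powLaw P 1 x = P x := by
    change (P x).bind Measure.dirac = P x
    exact Measure.bind_dirac
  have hrest : ∀ h : ℝ≥0, ∃ R : ℝ, 0 ≤ R ∧ R ≤ 1 - poissonWeight Λ h 0 - poissonWeight Λ h 1 ∧
      (jumpLaw P Λ h x).real {y} = poissonWeight Λ h 0 * d + poissonWeight Λ h 1 * a + R := by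
    intro h
    have hw := hasSum_poissonWeight hΛ.out h.coe_nonneg
    have hw0 := poissonWeight_nonneg hΛ.out h.coe_nonneg
    have hle : ∀ n, poissonWeight Λ h n * (powLaw P n x).real {y} ≤ poissonWeight Λ h n :=
      fun n => mul_le_of_le_one_right (hw0 n) measureReal_le_one
    have hnn : ∀ n, 0 ≤ poissonWeight Λ h n * (powLaw P n x).real {y} :=
      fun n => mul_nonneg (hw0 n) measureReal_nonneg
    have hs := Summable.of_nonneg_of_le hnn hle hw.summable
    have hr : (jumpLaw P Λ h x).real {y} = ∑' n, poissonWeight Λ h n * (powLaw P n x).real {y} := by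
      rw [measureReal_def, jumpLaw, Measure.sum_apply _ (measurableSet_singleton y),
        ENNReal.tsum_toReal_eq]
      · refine tsum_congr fun n => ?_
        rw [Measure.smul_apply, smul_eq_mul, ENNReal.toReal_mul, ENNReal.toReal_ofReal (hw0 n)]
        rfl
      · intro n
        rw [Measure.smul_apply, smul_eq_mul]
        exact ENNReal.mul_ne_top ENNReal.ofReal_ne_top (measure_ne_top _ _)
    refine ⟨∑' n, poissonWeight Λ h (n + 2) * (powLaw P (n + 2) x).real {y},
      tsum_nonneg fun n => hnn _, ?_, ?_⟩
    · have h1 := hw.summable.sum_add_tsum_nat_add 2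
      rw [hw.tsum_eq, Finset.sum_range_succ, Finset.sum_range_one] at h1
      have h2 := ((summable_nat_add_iff 2).2 hs).tsum_le_tsum (fun n => hle (n + 2))
        ((summable_nat_add_iff 2).2 hw.summable)
      linarith
    · rw [hr, ← hs.sum_add_tsum_nat_add 2, Finset.sum_range_succ, Finset.sum_range_one, hpow1]
      rfl
  choose R hR0 hR1 hR using hrest
  have hexp : Tendsto (fun h : ℝ => (Real.exp (-(Λ * h)) - 1) / h) (𝓝[>] 0) (𝓝 (-Λ)) := by
    have h1 : HasDerivAt (fun h : ℝ => Real.exp (-(Λ * h))) (-Λ) 0 := by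
      have := (((hasDerivAt_id (0 : ℝ)).const_mul Λ).neg).exp
      simpa using this
    have h2 := h1.hasDerivWithinAt (s := Set.Ioi 0)
    rw [hasDerivWithinAt_iff_tendsto_slope' Set.self_notMem_Ioi] at h2
    refine h2.congr fun h => ?_
    simp [slope_def_field]
  have h0 : Tendsto (fun h : ℝ≥0 => (poissonWeight Λ h 0 - 1) / (h : ℝ)) (𝓝[>] 0) (𝓝 (-Λ)) := by
    refine (hexp.comp tendsto_coe_nhdsGT_zero).congr fun h => ?_
    simp [poissonWeight]
  have h1 : Tendsto (fun h : ℝ≥0 => poissonWeight Λ h 1 / (h : ℝ)) (𝓝[>] 0) (𝓝 Λ) := by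
    have hc : Tendsto (fun h : ℝ => Real.exp (-(Λ * h)) * Λ) (𝓝[>] 0) (𝓝 Λ) := by
      have : Continuous fun h : ℝ => Real.exp (-(Λ * h)) * Λ := by fun_prop
      have h2 := this.tendsto 0
      simp only [mul_zero, neg_zero, Real.exp_zero, one_mul] at h2
      exact h2.mono_left nhdsWithin_le_nhds
    refine (hc.comp tendsto_coe_nhdsGT_zero).congr' ?_
    filter_upwards [self_mem_nhdsWithin] with h hh
    have hh' : (h : ℝ) ≠ 0 := ne_of_gt (NNReal.coe_pos.2 hh)
    simp only [Function.comp_apply, poissonWeight, pow_one, Nat.factorial_one, Nat.cast_one,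
      div_one]
    field_simp
  have h2 : Tendsto (fun h : ℝ≥0 => R h / (h : ℝ)) (𝓝[>] 0) (𝓝 0) := by
    have hup := (h0.add h1).neg
    rw [neg_add_cancel, neg_zero] at hup
    refine squeeze_zero (fun h => div_nonneg (hR0 h) h.coe_nonneg) (fun h => ?_) hup
    refine (div_le_div_of_nonneg_right (hR1 h) h.coe_nonneg).trans (le_of_eq ?_)
    ring
  have h3 := ((h0.mul_const d).add (h1.mul_const a)).add h2
  have hz : (jumpLaw P Λ (0 : ℝ≥0) x).real {y} = d := by rw [NNReal.coe_zero, jumpLaw_zero]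
  convert! h3 using 2
  · rw [hz, hR]; ring
  · ring

end Transition

/-! ### Laws on the Skorohod space -/

lemma measurable_skorohod_iff {S Ω : Type*} [TopologicalSpace S] [MeasurableSpace S]
    [MeasurableSpace Ω] {X : Ω → SkorohodSpace S} :
    Measurable X ↔ ∀ t, Measurable fun ω => (X ω).eval t := by
  rw [measurable_iff_le_map]
  refine iSup_le_iff.trans (forall_congr' fun t => ?_)
  rw [← MeasurableSpace.comap_le_iff_le_map, MeasurableSpace.comap_comp]
  exact measurable_iff_comap_le.symm

/-- A law on the Skorohod space over a countable set is determined by the probabilities of being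
in given states at given times, the first of which is `0`. -/
lemma SkorohodSpace.measure_ext {S : Type*} [TopologicalSpace S] [MeasurableSpace S]
    [DiscreteMeasurableSpace S] [Countable S] {μ ν : Measure (SkorohodSpace S)}
    [IsProbabilityMeasure μ] [IsProbabilityMeasure ν]
    (h : ∀ (n : ℕ) (t : Fin (n + 1) → ℝ≥0) (x : Fin (n + 1) → S), Monotone t → t 0 = 0 →
      μ {f | ∀ j, f.eval (t j) = x j} = ν {f | ∀ j, f.eval (t j) = x j}) : μ = ν := by
  set π : SkorohodSpace S → ℝ≥0 → S := fun f t => f.eval t with hπ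
  have hev : ∀ t, Measurable fun f : SkorohodSpace S => f.eval t :=
    measurable_skorohod_iff.1 measurable_id
  have hπm : Measurable π := measurable_pi_iff.2 hev
  have hfin : ∀ (I : Finset ℝ≥0), 0 ∈ I → ∀ x : ℝ≥0 → S,
      μ {f | ∀ t ∈ I, f.eval t = x t} = ν {f | ∀ t ∈ I, f.eval t = x t} := by
    intro I hI x
    obtain ⟨n, hn⟩ : ∃ n, I.card = n + 1 := Nat.exists_eq_succ_of_ne_zero
      (Finset.card_ne_zero_of_mem hI)
    have hrange : ∀ t ∈ I, ∃ j, I.orderEmbOfFin hn j = t := fun t ht => by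
      have : t ∈ Set.range (I.orderEmbOfFin hn) := by
        rw [Finset.range_orderEmbOfFin]; exact ht
      exact this
    have h0 : I.orderEmbOfFin hn 0 = 0 := by
      obtain ⟨j, hj⟩ := hrange 0 hI
      exact le_antisymm (((I.orderEmbOfFin hn).monotone (Fin.zero_le j)).trans hj.le) zero_le
    have key := h n (I.orderEmbOfFin hn) (fun j => x (I.orderEmbOfFin hn j))
      (I.orderEmbOfFin hn).monotone h0
    have hiff : ∀ f : SkorohodSpace S, (∀ t ∈ I, f.eval t = x t) ↔
        ∀ j, f.eval (I.orderEmbOfFin hn j) = x (I.orderEmbOfFin hn j) := by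
      intro f
      refine ⟨fun hf j => hf _ (I.orderEmbOfFin_mem hn j), fun hf t ht => ?_⟩
      obtain ⟨j, rfl⟩ := hrange t ht
      exact hf j
    simpa only [hiff] using key
  have hproj : μ.map π = ν.map π := by
    refine IsProjectiveLimit.unique
      (P := fun I : Finset ℝ≥0 => (ν.map π).map I.restrict) (fun I => ?_) (fun I => rfl)
    have hr : Measurable (I.restrict (π := fun _ : ℝ≥0 => S)) := Finset.measurable_restrict I
    change (μ.map π).map I.restrict = (ν.map π).map I.restrict
    rw [Measure.map_map hr hπm, Measure.map_map hr hπm]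
    refine Measure.ext_of_singleton fun a => ?_
    have hm := (hr.comp hπm) (measurableSet_singleton a)
    rw [Measure.map_apply (hr.comp hπm) (measurableSet_singleton a),
      Measure.map_apply (hr.comp hπm) (measurableSet_singleton a)]
    -- Split according to the state at time `0`.
    have hsplit : ∀ μ : Measure (SkorohodSpace S), μ ((I.restrict ∘ π) ⁻¹' {a}) =
        ∑' z : S, μ ({f | f.eval 0 = z} ∩ (I.restrict ∘ π) ⁻¹' {a}) := by
      intro μ
      have hU := measure_iUnion (μ := μ)
        (f := fun z : S => {f : SkorohodSpace S | f.eval 0 = z} ∩ (I.restrict ∘ π) ⁻¹' {a})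
        (fun i j hij => Set.disjoint_left.2 fun f hi hj => hij (hi.1.symm.trans hj.1))
        fun z => (hev 0 (measurableSet_singleton z)).inter hm
      rw [← hU]
      congr 1
      ext f
      simp
    rw [hsplit μ, hsplit ν]
    refine tsum_congr fun z => ?_
    by_cases hz : ∀ hI : (0 : ℝ≥0) ∈ I, a ⟨0, hI⟩ = z
    · set x : ℝ≥0 → S := fun t => if ht : t ∈ I then a ⟨t, ht⟩ else z with hx
      have hset : {f : SkorohodSpace S | f.eval 0 = z} ∩ (I.restrict ∘ π) ⁻¹' {a} =
          {f | ∀ t ∈ insert 0 I, f.eval t = x t} := by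
        ext f
        have hx0 : x 0 = z := by
          by_cases h0 : (0 : ℝ≥0) ∈ I <;> simp [hx, h0, hz]
        refine Iff.trans ?_ (Finset.forall_mem_insert _ _ _).symm
        rw [hx0]
        refine and_congr_right fun _ => ?_
        refine (funext_iff.trans Subtype.forall).trans
          (forall_congr' fun t => forall_congr' fun ht => ?_)
        simp [hx, ht, hπ]
      rw [hset]
      exact hfin (insert 0 I) (Finset.mem_insert_self _ _) x
    · have hempty : {f : SkorohodSpace S | f.eval 0 = z} ∩ (I.restrict ∘ π) ⁻¹' {a} = ∅ := by
        refine Set.eq_empty_of_forall_notMem fun f hf => hz fun hI => ?_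
        have h1 : I.restrict (π f) = a := hf.2
        rw [← h1]
        exact hf.1
      rw [hempty, measure_empty, measure_empty]
  have hcomap : ∀ A : Set (SkorohodSpace S), MeasurableSet A →
      ∃ B, MeasurableSet B ∧ π ⁻¹' B = A := by
    intro A hA
    have : (⨆ t : ℝ≥0, MeasurableSpace.comap (fun f : SkorohodSpace S => f.eval t) inferInstance) =
        MeasurableSpace.comap π MeasurableSpace.pi := by
      simp only [MeasurableSpace.pi, MeasurableSpace.comap_iSup, MeasurableSpace.comap_comp]
      rfl
    have hA' : MeasurableSet[MeasurableSpace.comap π MeasurableSpace.pi] A := this ▸ hA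
    exact hA'
  ext A hA
  obtain ⟨B, hB, rfl⟩ := hcomap A hA
  rw [← Measure.map_apply hπm hB, ← Measure.map_apply hπm hB, hproj]

/-! ### Uniformization of the transition rates -/

/-- The possible steps of the processes: up (`inl`) or down (`inr`) in one coordinate, or no change
(`none`). -/
abbrev Move (K : ℕ) : Type := Option ((Fin 2 × Fin K) ⊕ (Fin 2 × Fin K))

section Uniformization

variable {K : ℕ} {S : Set (State K)}

open Classical in
/-- The state reached from `x` by a move; moves that would leave `S` are not carried out. -/
noncomputable def move : Move K → S → S
  | none, x => x
  | some (.inl j), x =>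
    if h : (x : State K) + unitVec j.1 j.2 ∈ S then ⟨_, h⟩ else x
  | some (.inr j), x =>
    if h : ∃ y ∈ S, y + unitVec j.1 j.2 = (x : State K) then ⟨h.choose, h.choose_spec.1⟩ else x

/-- The probabilities of the moves from `x` at a tick of a clock of rate `Λ`. -/
noncomputable def moveProb (R : UnitRates S) (Λ : ℝ) (x : S) : Move K → ℝ
  | none => 1 - (∑ j : Fin 2 × Fin K, R.up j.1 j.2 x / Λ +
      ∑ j : Fin 2 × Fin K, R.down j.1 j.2 x / Λ)
  | some (.inl j) => R.up j.1 j.2 x / Λ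
  | some (.inr j) => R.down j.1 j.2 x / Λ

/-- The law of the state reached from `x` at a tick of a clock of rate `Λ`. -/
noncomputable def stepLaw (R : UnitRates S) (Λ : ℝ) (x : S) : Measure S :=
  ∑ m, ENNReal.ofReal (moveProb R Λ x m) • Measure.dirac (move m x)

/-- The clock rate `Λ` is at least twice the total rate of the transitions from any state. The
factor two leaves room for coupling the moves of two processes, where in one tick either a move of
one process, a move of the other, or a matched pair of moves takes place. -/
def Dominates (Λ : ℝ) (R : UnitRates S) : Prop :=
  ∀ x, ∑ j : Fin 2 × Fin K, R.up j.1 j.2 x / Λ + ∑ j : Fin 2 × Fin K, R.down j.1 j.2 x / Λ ≤ 1 / 2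

lemma Dominates.mono {Λ Λ' : ℝ} {R : UnitRates S} (h : Dominates Λ R) (hΛ : 0 < Λ) (hle : Λ ≤ Λ') :
    Dominates Λ' R := fun x => (add_le_add
      (Finset.sum_le_sum fun _ _ => div_le_div_of_nonneg_left (R.up_nonneg _ _ _) hΛ hle)
      (Finset.sum_le_sum fun _ _ => div_le_div_of_nonneg_left (R.down_nonneg _ _ _) hΛ hle)).trans
    (h x)

lemma exists_dominates (R : UnitRates S) : ∃ Λ, 0 < Λ ∧ Dominates Λ R := by
  choose C hC using R.up_bounded
  choose D hD using R.down_bounded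
  set B := ∑ j : Fin 2 × Fin K, |C j.1 j.2| + ∑ j : Fin 2 × Fin K, |D j.1 j.2| with hB
  have hB0 : 0 ≤ B := by positivity
  refine ⟨2 * B + 1, by positivity, fun x => ?_⟩
  rw [← Finset.sum_div, ← Finset.sum_div, ← add_div, div_le_iff₀ (by positivity)]
  have h1 : ∑ j : Fin 2 × Fin K, R.up j.1 j.2 x ≤ ∑ j : Fin 2 × Fin K, |C j.1 j.2| :=
    Finset.sum_le_sum fun j _ => (hC _ _ x).trans (le_abs_self _)
  have h2 : ∑ j : Fin 2 × Fin K, R.down j.1 j.2 x ≤ ∑ j : Fin 2 × Fin K, |D j.1 j.2| :=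
    Finset.sum_le_sum fun j _ => (hD _ _ x).trans (le_abs_self _)
  linarith

variable {R : UnitRates S} {Λ : ℝ}

lemma moveProb_nonneg (hΛ : 0 < Λ) (hR : Dominates Λ R) (x : S) (m : Move K) :
    0 ≤ moveProb R Λ x m := by
  rcases m with _ | j | j
  · have := hR x
    simp only [moveProb]
    linarith
  · exact div_nonneg (R.up_nonneg _ _ _) hΛ.le
  · exact div_nonneg (R.down_nonneg _ _ _) hΛ.le

lemma sum_moveProb (x : S) : ∑ m, moveProb R Λ x m = 1 := by
  rw [Fintype.sum_option, Fintype.sum_sum_type]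
  simp [moveProb]

lemma isProbabilityMeasure_stepLaw (hΛ : 0 < Λ) (hR : Dominates Λ R) (x : S) :
    IsProbabilityMeasure (stepLaw R Λ x) := by
  refine ⟨?_⟩
  simp only [stepLaw, Measure.coe_finsetSum, Finset.sum_apply, Measure.smul_apply,
    measure_univ, smul_eq_mul, mul_one]
  rw [← ENNReal.ofReal_sum_of_nonneg fun m _ => moveProb_nonneg hΛ hR x m, sum_moveProb,
    ENNReal.ofReal_one]

open Classical in
lemma stepLaw_real_singleton (hΛ : 0 < Λ) (hR : Dominates Λ R) (x y : S) :
    (stepLaw R Λ x).real {y} = ∑ m, moveProb R Λ x m * if y = move m x then 1 else 0 := by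
  rw [measureReal_def, stepLaw]
  simp only [Measure.coe_finsetSum, Finset.sum_apply, Measure.smul_apply, smul_eq_mul]
  rw [ENNReal.toReal_sum fun m _ => ENNReal.mul_ne_top ENNReal.ofReal_ne_top (measure_ne_top _ _)]
  refine Finset.sum_congr rfl fun m _ => ?_
  rw [ENNReal.toReal_mul, ENNReal.toReal_ofReal (moveProb_nonneg hΛ hR x m), Measure.dirac_apply]
  by_cases h : y = move m x
  · simp [h]
  · simp [h, Ne.symm h]

lemma coe_move_up {j : Fin 2 × Fin K} {x : S} (h : R.up j.1 j.2 x ≠ 0) :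
    (move (some (.inl j)) x : State K) = x + unitVec j.1 j.2 := by
  have hmem : (x : State K) + unitVec j.1 j.2 ∈ S := by
    by_contra hn
    exact h (R.up_eq_zero _ _ _ hn)
  simp [move, hmem]

lemma coe_move_down {j : Fin 2 × Fin K} {x : S} (h : R.down j.1 j.2 x ≠ 0) :
    (move (some (.inr j)) x : State K) + unitVec j.1 j.2 = x := by
  have hmem : ∃ y ∈ S, y + unitVec j.1 j.2 = (x : State K) := by
    by_contra! hn
    exact h (R.down_eq_zero _ _ _ hn)
  rw [move, dif_pos hmem]
  exact hmem.choose_spec.2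

open Classical in
lemma generator_eq (hΛ : 0 < Λ) (hR : Dominates Λ R) (x y : S) :
    R.generator x y = Λ * ((stepLaw R Λ x).real {y} - (Measure.dirac x).real {y}) := by
  have hd : (Measure.dirac x).real {y} = if y = x then 1 else 0 := by
    rw [measureReal_def, Measure.dirac_apply]
    by_cases h : y = x
    · simp [h]
    · simp [h, Ne.symm h]
  have hup : ∀ j : Fin 2 × Fin K,
      (R.up j.1 j.2 x * if y = move (some (.inl j)) x then 1 else 0) =
        R.up j.1 j.2 x * if (y : State K) = (x : State K) + unitVec j.1 j.2 then 1 else 0 := by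
    intro j
    by_cases h : R.up j.1 j.2 x = 0
    · simp [h]
    · simp only [Subtype.ext_iff, coe_move_up h]
  have hdown : ∀ j : Fin 2 × Fin K,
      (R.down j.1 j.2 x * if y = move (some (.inr j)) x then 1 else 0) =
        R.down j.1 j.2 x * if (y : State K) + unitVec j.1 j.2 = (x : State K) then 1 else 0 := by
    intro j
    by_cases h : R.down j.1 j.2 x = 0
    · simp [h]
    · have := coe_move_down h
      simp only [Subtype.ext_iff]
      congr 2
      rw [← this]
      simp
  rw [stepLaw_real_singleton hΛ hR, hd, Fintype.sum_option, Fintype.sum_sum_type,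
    UnitRates.generator]
  simp only [moveProb]
  have e1 : ∑ j : Fin 2 × Fin K,
      R.up j.1 j.2 x / Λ * (if y = move (some (.inl j)) x then 1 else 0) =
      (∑ j : Fin 2 × Fin K, R.up j.1 j.2 x *
        if (y : State K) = (x : State K) + unitVec j.1 j.2 then 1 else 0) / Λ := by
    rw [Finset.sum_div]
    exact Finset.sum_congr rfl fun j _ => by rw [← hup]; ring
  have e2 : ∑ j : Fin 2 × Fin K,
      R.down j.1 j.2 x / Λ * (if y = move (some (.inr j)) x then 1 else 0) =
      (∑ j : Fin 2 × Fin K, R.down j.1 j.2 x *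
        if (y : State K) + unitVec j.1 j.2 = (x : State K) then 1 else 0) / Λ := by
    rw [Finset.sum_div]
    exact Finset.sum_congr rfl fun j _ => by rw [← hdown]; ring
  rw [e1, e2, show move none x = x from rfl]
  simp only [mul_sub, Finset.sum_sub_distrib, ← Finset.sum_mul, ← Finset.sum_div,
    Fintype.sum_prod_type]
  field_simp
  ring

open Classical in
/-- The generator is conservative. -/
lemma sum_generator (hΛ : 0 < Λ) (hR : Dominates Λ R) (x : S) :
    ∑ y ∈ Finset.univ.image (fun m => move m x), R.generator x y = 0 := by
  have h1 : ∑ y ∈ Finset.univ.image (fun m => move m x), (stepLaw R Λ x).real {y} = 1 := by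
    simp_rw [stepLaw_real_singleton hΛ hR]
    rw [Finset.sum_comm]
    refine Eq.trans ?_ (sum_moveProb (R := R) (Λ := Λ) x)
    refine Finset.sum_congr rfl fun m _ => ?_
    rw [← Finset.mul_sum, Finset.sum_ite_eq',
      if_pos (Finset.mem_image_of_mem _ (Finset.mem_univ m)),
      mul_one]
  have h2 : ∑ y ∈ Finset.univ.image (fun m => move m x), (Measure.dirac x).real {y} = 1 := by
    have : ∀ y, (Measure.dirac x).real {y} = if y = x then 1 else 0 := fun y => by
      rw [measureReal_def, Measure.dirac_apply]
      by_cases h : y = x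
      · simp [h]
      · simp [h, Ne.symm h]
    simp_rw [this]
    have hx : x ∈ Finset.univ.image (fun m => move m x) :=
      Finset.mem_image.2 ⟨none, Finset.mem_univ _, rfl⟩
    rw [Finset.sum_ite_eq', if_pos hx]
  simp_rw [generator_eq hΛ hR]
  rw [← Finset.mul_sum, Finset.sum_sub_distrib, h1, h2, sub_self, mul_zero]

lemma neg_generator_le (hΛ : 0 < Λ) (hR : Dominates Λ R) (x : S) : -R.generator x x ≤ Λ := by
  have h1 : 0 ≤ (stepLaw R Λ x).real {x} := measureReal_nonneg
  have h2 : (Measure.dirac x).real {x} = 1 := by simp [measureReal_def]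
  rw [generator_eq hΛ hR, h2]
  nlinarith

end Uniformization

/-! ### Markov processes with given rates -/

section Markov

variable {K : ℕ} {S : Set (State K)} {R : UnitRates S}

/-- The rates and the initial law determine the law of the process. -/
theorem IsMarkovWithRates.map_eq {Ω Ω' : Type*} [MeasurableSpace Ω] [MeasurableSpace Ω']
    {P : Measure Ω} [IsProbabilityMeasure P] {P' : Measure Ω'} [IsProbabilityMeasure P']
    {X : Ω → SkorohodSpace S} {Y : Ω' → SkorohodSpace S}
    (hX : IsMarkovWithRates R P X) (hY : IsMarkovWithRates R P' Y)
    (h0 : P.map (fun ω => (X ω).eval 0) = P'.map (fun ω => (Y ω).eval 0)) :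
    P.map X = P'.map Y := by
  classical
  obtain ⟨p, hp, hpq, hXm⟩ := hX.markov
  obtain ⟨r, hr, hrq, hYm⟩ := hY.markov
  obtain ⟨Λ, hΛ, hR⟩ := exists_dominates R
  obtain rfl : p = r := hp.eq_of_generator hr (fun x => sum_generator hΛ hR x)
    (fun x => Finset.mem_image.2 ⟨none, Finset.mem_univ _, rfl⟩)
    (fun x => neg_generator_le hΛ hR x) hpq hrq
  have := Measure.isProbabilityMeasure_map (μ := P) hX.measurable.aemeasurable
  have := Measure.isProbabilityMeasure_map (μ := P') hY.measurable.aemeasurable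
  have hev : ∀ t, Measurable fun f : SkorohodSpace S => f.eval t :=
    measurable_skorohod_iff.1 measurable_id
  refine SkorohodSpace.measure_ext fun n t x ht ht0 => ?_
  have hm : MeasurableSet {f : SkorohodSpace S | ∀ j, f.eval (t j) = x j} :=
    measurableSet_setOfPred.2 (Measurable.forall fun j => measurableSet_setOfPred.1
      (hev (t j) (measurableSet_singleton (x j))))
  rw [Measure.map_apply hX.measurable hm, Measure.map_apply hY.measurable hm]
  change P {ω | ∀ j, (X ω).eval (t j) = x j} = P' {ω | ∀ j, (Y ω).eval (t j) = x j}
  clear hm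
  induction n with
  | zero =>
    have h1 := congrArg (fun μ => μ {x 0}) h0
    rw [Measure.map_apply (measurable_skorohod_iff.1 hX.measurable 0) (measurableSet_singleton _),
      Measure.map_apply (measurable_skorohod_iff.1 hY.measurable 0) (measurableSet_singleton _)]
      at h1
    simp only [Nat.reduceAdd, Fin.forall_fin_one, ht0]
    exact h1
  | succ n ih =>
    have hsplit : ∀ f : SkorohodSpace S, (∀ j, f.eval (t j) = x j) ↔
        (∀ j : Fin (n + 1), f.eval (t j.castSucc) = x j.castSucc) ∧
          f.eval (t (Fin.last n).castSucc + (t (Fin.last (n + 1)) - t (Fin.last n).castSucc)) =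
            x (Fin.last (n + 1)) := by
      intro f
      rw [add_tsub_cancel_of_le (ht (Fin.le_last _)), Fin.forall_fin_succ']
    have hmono : Monotone fun j : Fin (n + 1) => t j.castSucc := fun i j hij =>
      ht (Fin.castSucc_le_castSucc_iff.2 hij)
    rw [Set.ext fun ω => hsplit (X ω), Set.ext fun ω => hsplit (Y ω),
      hXm n (fun j => t j.castSucc) (fun j => x j.castSucc) hmono,
      hYm n (fun j => t j.castSucc) (fun j => x j.castSucc) hmono,
      ih (fun j => t j.castSucc) (fun j => x j.castSucc) hmono ht0]

/-- If the steps of a chain on `E` project under `f` to steps with the law `stepLaw R Λ`, the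
projected process is a Markov process with the rates `R`, for every initial law on `E`. -/
theorem isMarkovWithRates_path {E : Type*} [MeasurableSpace E] [DiscreteMeasurableSpace E]
    [Countable E] {κ : E → Measure E} [∀ e, IsProbabilityMeasure (κ e)] {Λ : ℝ}
    [hΛ : Fact (0 < Λ)] (hR : Dominates Λ R) {f : E → S}
    (hf : ∀ e, (κ e).map f = stepLaw R Λ (f e)) (ρ : Measure E) [IsProbabilityMeasure ρ] :
    IsMarkovWithRates R (ρ.prod (noiseLaw κ Λ)) fun p => path f p.1 p.2 := by
  have : ∀ x, IsProbabilityMeasure (stepLaw R Λ x) := isProbabilityMeasure_stepLaw hΛ.out hR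
  have hfm : Measurable f := Measurable.of_discrete
  have hev : ∀ t : ℝ≥0, Measurable fun p : E × Noise E => (path f p.1 p.2).eval t := fun t =>
    hfm.comp (measurable_stateAt t)
  refine ⟨measurable_skorohod_iff.2 hev, _, isTransitionFunction_jumpLaw (stepLaw R Λ) Λ,
    fun x y => ?_, fun n t x ht h y => ?_⟩
  · rw [generator_eq hΛ.out hR]
    exact tendsto_jumpLaw_sub_div _ _ x y
  · have hA : MeasurableSet {p : E × Noise E | ∀ j, (path f p.1 p.2).eval (t j) = x j} :=
      measurableSet_setOfPred.2 (Measurable.forall fun j => measurableSet_setOfPred.1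
        (hev (t j) (measurableSet_singleton (x j))))
    have hB : MeasurableSet {p : E × Noise E | (∀ j, (path f p.1 p.2).eval (t j) = x j) ∧
        (path f p.1 p.2).eval (t (Fin.last n) + h) = y} :=
      hA.inter (hev _ (measurableSet_singleton y))
    have hprob := isProbabilityMeasure_jumpLaw (stepLaw R Λ) Λ h.coe_nonneg (x (Fin.last n))
    rw [Measure.prod_apply hA, Measure.prod_apply hB, ofReal_measureReal,
      ← lintegral_mul_const _ Measurable.of_discrete]
    exact lintegral_congr fun e => noiseLaw_markov κ Λ hf n t x ht h y e

end Markov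

/-! ### Effect of the transitions on the preorder -/

section Order

variable {K : ℕ} {x y : State K}

lemma total_add_unitVec (x : State K) (i : Fin 2) (k : Fin K) :
    total (x + unitVec i k) = total x + 1 := by
  have h : total (unitVec i k) = 1 := by
    unfold total unitVec
    rw [Finset.sum_eq_single i (fun b _ hb => by simp [hb]) (by simp), Pi.single_eq_same]
    simp
  rw [← h]
  simp [total, Finset.sum_add_distrib]

lemma add_unitVec_layer (x : State K) (i : Fin 2) (k l : Fin K) :
    (x + unitVec i k) 0 l = x 0 l + if i = 0 ∧ l = k then 1 else 0 := by
  simp only [unitVec, Pi.add_apply]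
  by_cases hi : i = 0
  · subst hi
    by_cases hl : l = k
    · subst hl; simp
    · simp [hl]
  · simp [hi, Ne.symm hi]

lemma Prec.add_add {i j : Fin 2 × Fin K} (h : Prec x y)
    (hij : i.1 = 0 ∧ x 0 i.2 = y 0 i.2 → j = i) :
    Prec (x + unitVec i.1 i.2) (y + unitVec j.1 j.2) := by
  refine ⟨fun l => ?_, by rw [total_add_unitVec, total_add_unitVec]; exact Nat.succ_le_succ h.2⟩
  have hl := h.1 l
  rw [add_unitVec_layer, add_unitVec_layer]
  by_cases hi : i.1 = 0 ∧ l = i.2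
  · obtain ⟨h0, rfl⟩ := hi
    by_cases he : x 0 i.2 = y 0 i.2
    · rw [hij ⟨h0, he⟩]; simp [h0, he]
    · simp only [h0, and_self, if_true]; omega
  · simp only [hi, if_false]; omega

lemma Prec.add_left {i : Fin 2 × Fin K} (h : Prec x y)
    (hi : ¬(total x = total y ∨ i.1 = 0 ∧ x 0 i.2 = y 0 i.2)) :
    Prec (x + unitVec i.1 i.2) y := by
  push Not at hi
  have ht := h.2
  refine ⟨fun l => ?_, by rw [total_add_unitVec]; omega⟩
  have hl := h.1 l
  rw [add_unitVec_layer]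
  by_cases h0 : i.1 = 0 ∧ l = i.2
  · obtain ⟨h0, rfl⟩ := h0
    have := hi.2 h0
    simp only [h0, and_self, if_true]; omega
  · simp only [h0, if_false]; omega

lemma Prec.add_right (h : Prec x y) (j : Fin 2 × Fin K) : Prec x (y + unitVec j.1 j.2) :=
  ⟨fun l => (h.1 l).trans (Nat.le_add_right _ _), by
    rw [total_add_unitVec]; exact h.2.trans (Nat.le_succ _)⟩

lemma Prec.of_add_add {i j : Fin 2 × Fin K}
    (h : Prec (x + unitVec j.1 j.2) (y + unitVec i.1 i.2))
    (hij : i.1 = 0 ∧ (x + unitVec j.1 j.2) 0 i.2 = (y + unitVec i.1 i.2) 0 i.2 → j = i) :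
    Prec x y := by
  have ht := h.2
  rw [total_add_unitVec, total_add_unitVec] at ht
  refine ⟨fun l => ?_, Nat.le_of_succ_le_succ ht⟩
  have hl := h.1 l
  by_cases hi : i.1 = 0 ∧ l = i.2
  · obtain ⟨h0, rfl⟩ := hi
    by_cases he : (x + unitVec j.1 j.2) 0 i.2 = (y + unitVec i.1 i.2) 0 i.2
    · rw [hij ⟨h0, he⟩, add_unitVec_layer, add_unitVec_layer] at hl
      omega
    · have hlt := lt_of_le_of_ne hl he
      rw [add_unitVec_layer, add_unitVec_layer] at hlt
      simp only [h0, and_self, if_true] at hlt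
      omega
  · rw [add_unitVec_layer, add_unitVec_layer] at hl
    simp only [hi, if_false] at hl
    omega

lemma Prec.of_add_right {i : Fin 2 × Fin K} (h : Prec x (y + unitVec i.1 i.2))
    (hi : ¬(total x = total (y + unitVec i.1 i.2) ∨
      i.1 = 0 ∧ x 0 i.2 = (y + unitVec i.1 i.2) 0 i.2)) : Prec x y := by
  push Not at hi
  have ht := h.2
  rw [total_add_unitVec] at ht hi
  refine ⟨fun l => ?_, by omega⟩
  have hl := h.1 l
  by_cases h0 : i.1 = 0 ∧ l = i.2
  · obtain ⟨h0, rfl⟩ := h0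
    have hne := hi.2 h0
    rw [add_unitVec_layer] at hl hne
    simp only [h0, and_self, if_true] at hl hne
    omega
  · rw [add_unitVec_layer] at hl
    simp only [h0, if_false] at hl
    omega

lemma Prec.of_add_left {j : Fin 2 × Fin K} (h : Prec (x + unitVec j.1 j.2) y) : Prec x y := by
  have ht := h.2
  rw [total_add_unitVec] at ht
  exact ⟨fun l => (Nat.le_add_right _ _).trans (h.1 l), by omega⟩

end Order

/-! ### Coupling of the transitions -/

/-- A partial transport plan `u` from the weights `a` to the weights `b`. The mass of `a` at the
points of `T`, where `a ≤ b`, is matched completely and in place. In case `B`, in which the total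
mass of `a` is at most that of `b`, the mass at all other points is matched completely as well, by
spreading it proportionally over what is left of `b`. -/
lemma exists_transport {J : Type*} [Fintype J] {a b : J → ℝ} (ha : ∀ j, 0 ≤ a j)
    (hb : ∀ j, 0 ≤ b j) {T : J → Prop} (hT : ∀ j, T j → a j ≤ b j) {B : Prop}
    (hB : B → ∑ j, a j ≤ ∑ j, b j) :
    ∃ u : J → J → ℝ, (∀ i j, 0 ≤ u i j) ∧ (∀ i, ∑ j, u i j ≤ a i) ∧ (∀ j, ∑ i, u i j ≤ b j) ∧
      (∀ i, B ∨ T i → ∑ j, u i j = a i) ∧ ∀ i j, T i → u i j ≠ 0 → j = i := by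
  classical
  -- What is left of `b`, and the mass `f` that is spread over it.
  set r : J → ℝ := fun j => b j - if T j then a j else 0 with hr
  set ρ : ℝ := ∑ j, r j with hρ
  have hr0 : ∀ j, 0 ≤ r j := fun j => by
    by_cases h : T j
    · simp [hr, h, hT j h]
    · simp [hr, h, hb j]
  have hρ0 : 0 ≤ ρ := Finset.sum_nonneg fun j _ => hr0 j
  set f : J → ℝ := fun i => if B ∧ ¬T i then a i else 0 with hf
  have hf0 : ∀ i, 0 ≤ f i := fun i => by
    by_cases h : B ∧ ¬T i <;> simp [hf, h, ha i]
  have hfρ : ∑ i, f i ≤ ρ := by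
    by_cases h : B
    · have h1 : ∑ i, f i = ∑ i, a i - ∑ i, if T i then a i else 0 := by
        rw [← Finset.sum_sub_distrib]
        refine Finset.sum_congr rfl fun i _ => ?_
        by_cases hi : T i <;> simp [hf, h, hi]
      rw [h1, hρ]
      simp only [hr, Finset.sum_sub_distrib]
      linarith [hB h]
    · simpa [hf, h] using hρ0
  have hfrow : ∀ i, f i * ρ / ρ = f i := fun i => by
    by_cases h : ρ = 0
    · have h1 : f i ≤ 0 := (Finset.single_le_sum (fun j _ => hf0 j) (Finset.mem_univ i)).trans
        (hfρ.trans h.le)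
      simp [le_antisymm h1 (hf0 i)]
    · field_simp
  have hrow : ∀ i, ∑ j, ((if T i ∧ j = i then a i else 0) + f i * r j / ρ) =
      (if T i then a i else 0) + f i := fun i => by
    rw [Finset.sum_add_distrib, ← Finset.sum_div, ← Finset.mul_sum, hfrow]
    congr 1
    by_cases h : T i <;> simp [h]
  refine ⟨fun i j => (if T i ∧ j = i then a i else 0) + f i * r j / ρ, fun i j => ?_, fun i => ?_,
    fun j => ?_, fun i hi => ?_, fun i j hi hij => ?_⟩
  · have h1 := hf0 i
    have h2 := hr0 j
    have h3 : 0 ≤ if T i ∧ j = i then a i else 0 := by split_ifs; exacts [ha i, le_rfl]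
    positivity
  · rw [hrow]
    by_cases h : T i
    · simp [hf, h]
    · by_cases h' : B <;> simp [hf, h, h', ha i]
  · have h1 : ∑ i, (if T i ∧ j = i then a i else 0) = if T j then a j else 0 := by
      rw [Finset.sum_eq_single j (fun i _ hi => by simp [Ne.symm hi]) (by simp)]
      simp
    rw [Finset.sum_add_distrib, h1, ← Finset.sum_div, ← Finset.sum_mul]
    have h2 : (∑ i, f i) * r j / ρ ≤ r j :=
      div_le_of_le_mul₀ hρ0 (hr0 j) (by
        rw [mul_comm (r j)]; exact mul_le_mul_of_nonneg_right hfρ (hr0 j))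
    have h3 : r j = b j - if T j then a j else 0 := rfl
    linarith
  · rw [hrow]
    by_cases h : T i
    · simp [hf, h]
    · simp [hf, h, hi.resolve_right h]
  · by_contra hne
    exact hij (by simp [hf, hi, hne])

section Coupling

variable {K : ℕ} {S : Set (State K)} {R R' : UnitRates S} {Λ : ℝ}

/-- The moves of `X` from `x` and of `Y` from `y ⪰ x` can be coupled so that the order is preserved:
an upward move of `X` that would break the order is matched with an upward move of `Y`, and a
downward move of `Y` that would break it with a downward move of `X`. -/
lemma exists_moveProb_coupling (hΛ : 0 < Λ) (hR : Dominates Λ R) (hR' : Dominates Λ R')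
    {x y : S} (hxy : Prec (x : State K) y)
    (h_layer_up : ∀ k, (x : State K) 0 k = (y : State K) 0 k → R.up 0 k x ≤ R'.up 0 k y)
    (h_layer_down : ∀ k, (x : State K) 0 k = (y : State K) 0 k → R'.down 0 k y ≤ R.down 0 k x)
    (h_total_up : total (x : State K) = total (y : State K) →
      ∑ i, ∑ k, R.up i k x ≤ ∑ i, ∑ k, R'.up i k y)
    (h_total_down : total (x : State K) = total (y : State K) →
      ∑ i, ∑ k, R'.down i k y ≤ ∑ i, ∑ k, R.down i k x) :
    ∃ w : Move K → Move K → ℝ, (∀ m m', 0 ≤ w m m') ∧ (∀ m, ∑ m', w m m' = moveProb R Λ x m) ∧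
      (∀ m', ∑ m, w m m' = moveProb R' Λ y m') ∧
      ∀ m m', w m m' ≠ 0 → Prec (move m x : State K) (move m' y) := by
  obtain ⟨u, hu0, hua, hub, huB, huT⟩ := exists_transport
    (a := fun j : Fin 2 × Fin K => R.up j.1 j.2 x / Λ) (b := fun j => R'.up j.1 j.2 y / Λ)
    (fun j => div_nonneg (R.up_nonneg _ _ _) hΛ.le)
    (fun j => div_nonneg (R'.up_nonneg _ _ _) hΛ.le)
    (T := fun j => j.1 = 0 ∧ (x : State K) 0 j.2 = (y : State K) 0 j.2)
    (fun j hj => div_le_div_of_nonneg_right (by rw [hj.1]; exact h_layer_up _ hj.2) hΛ.le)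
    (B := total (x : State K) = total (y : State K))
    (fun h => by
      rw [← Finset.sum_div, ← Finset.sum_div, Fintype.sum_prod_type, Fintype.sum_prod_type]
      exact div_le_div_of_nonneg_right (h_total_up h) hΛ.le)
  obtain ⟨v, hv0, hva, hvb, hvB, hvT⟩ := exists_transport
    (a := fun j : Fin 2 × Fin K => R'.down j.1 j.2 y / Λ) (b := fun j => R.down j.1 j.2 x / Λ)
    (fun j => div_nonneg (R'.down_nonneg _ _ _) hΛ.le)
    (fun j => div_nonneg (R.down_nonneg _ _ _) hΛ.le)
    (T := fun j => j.1 = 0 ∧ (x : State K) 0 j.2 = (y : State K) 0 j.2)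
    (fun j hj => div_le_div_of_nonneg_right (by rw [hj.1]; exact h_layer_down _ hj.2) hΛ.le)
    (B := total (x : State K) = total (y : State K))
    (fun h => by
      rw [← Finset.sum_div, ← Finset.sum_div, Fintype.sum_prod_type, Fintype.sum_prod_type]
      exact div_le_div_of_nonneg_right (h_total_down h) hΛ.le)
  have hx := hR x
  have hy := hR' y
  -- Moves with a positive rate stay within `S`, so they are really carried out.
  have hupx : ∀ i, 0 < R.up i.1 i.2 x / Λ →
      (move (some (.inl i)) x : State K) = x + unitVec i.1 i.2 := fun i hi =>
    coe_move_up (R := R) fun h => hi.ne' (by rw [h, zero_div])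
  have hupy : ∀ i, 0 < R'.up i.1 i.2 y / Λ →
      (move (some (.inl i)) y : State K) = y + unitVec i.1 i.2 := fun i hi =>
    coe_move_up (R := R') fun h => hi.ne' (by rw [h, zero_div])
  have hdownx : ∀ i, 0 < R.down i.1 i.2 x / Λ →
      (move (some (.inr i)) x : State K) + unitVec i.1 i.2 = x := fun i hi =>
    coe_move_down (R := R) fun h => hi.ne' (by rw [h, zero_div])
  have hdowny : ∀ i, 0 < R'.down i.1 i.2 y / Λ →
      (move (some (.inr i)) y : State K) + unitVec i.1 i.2 = y := fun i hi =>
    coe_move_down (R := R') fun h => hi.ne' (by rw [h, zero_div])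
  have hle : ∀ {w : Fin 2 × Fin K → ℝ} (i), (∀ j, 0 ≤ w j) → w i ≤ ∑ j, w j := fun i h =>
    Finset.single_le_sum (fun j _ => h j) (Finset.mem_univ i)
  have hswap_u : ∑ j, ∑ i, u i j = ∑ i, ∑ j, u i j := Finset.sum_comm
  have hswap_v : ∑ j, ∑ i, v i j = ∑ i, ∑ j, v i j := Finset.sum_comm
  have hsu : 0 ≤ ∑ i, ∑ j, u i j :=
    Finset.sum_nonneg fun i _ => Finset.sum_nonneg fun j _ => hu0 i j
  have hsv : 0 ≤ ∑ i, ∑ j, v i j :=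
    Finset.sum_nonneg fun i _ => Finset.sum_nonneg fun j _ => hv0 i j
  let w : Move K → Move K → ℝ
    -- The unmatched moves are made alone, with what remains of their probabilities.
    | none, none => 1 - (∑ i : Fin 2 × Fin K, R.up i.1 i.2 x / Λ +
          ∑ i : Fin 2 × Fin K, R.down i.1 i.2 x / Λ) -
        (∑ i : Fin 2 × Fin K, R'.up i.1 i.2 y / Λ + ∑ i : Fin 2 × Fin K, R'.down i.1 i.2 y / Λ) +
        ∑ i, ∑ j, u i j + ∑ i, ∑ j, v i j
    | some (.inl i), none => R.up i.1 i.2 x / Λ - ∑ j, u i j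
    | none, some (.inl j) => R'.up j.1 j.2 y / Λ - ∑ i, u i j
    | some (.inl i), some (.inl j) => u i j
    | none, some (.inr i) => R'.down i.1 i.2 y / Λ - ∑ j, v i j
    | some (.inr j), none => R.down j.1 j.2 x / Λ - ∑ i, v i j
    | some (.inr j), some (.inr i) => v i j
    | some (.inl _), some (.inr _) => 0
    | some (.inr _), some (.inl _) => 0
  refine ⟨w, fun m m' => ?_, fun m => ?_, fun m' => ?_, fun m m' hw => ?_⟩
  · rcases m with _ | i | i <;> rcases m' with _ | j | j <;> simp only [w]
    · linarith
    · linarith [hub j]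
    · linarith [hva j]
    · linarith [hua i]
    · exact hu0 i j
    · exact le_rfl
    · linarith [hvb i]
    · exact le_rfl
    · exact hv0 j i
  · rw [Fintype.sum_option, Fintype.sum_sum_type]
    rcases m with _ | i | i <;> simp only [w, moveProb, Finset.sum_sub_distrib,
      Finset.sum_const_zero, hswap_u]
    · ring
    · ring
    · ring
  · rw [Fintype.sum_option, Fintype.sum_sum_type]
    rcases m' with _ | i | i <;> simp only [w, moveProb, Finset.sum_sub_distrib,
      Finset.sum_const_zero, hswap_v]
    · ring
    · ring
    · ring
  · rcases m with _ | i | i <;> rcases m' with _ | j | j <;> simp only [w] at hw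
    · exact hxy
    · have hpos : 0 < R'.up j.1 j.2 y / Λ := by
        have h1 := hub j
        have h2 : 0 ≤ ∑ i, u i j := Finset.sum_nonneg fun i _ => hu0 i j
        rcases lt_or_eq_of_le (h2.trans h1) with h | h
        · exact h
        · exact absurd (by linarith) hw
      rw [hupy j hpos]
      exact hxy.add_right j
    · have hne : ¬(total (x : State K) = total (y : State K) ∨
          j.1 = 0 ∧ (x : State K) 0 j.2 = (y : State K) 0 j.2) := fun h =>
        hw (by rw [hvB j h, sub_self])
      have hpos : 0 < R'.down j.1 j.2 y / Λ := by
        have h1 := hva j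
        have h2 : 0 ≤ ∑ i, v j i := Finset.sum_nonneg fun i _ => hv0 j i
        rcases lt_or_eq_of_le (h2.trans h1) with h | h
        · exact h
        · exact absurd (by linarith) hw
      have he := hdowny j hpos
      rw [← he] at hxy hne
      exact hxy.of_add_right hne
    · have hne : ¬(total (x : State K) = total (y : State K) ∨
          i.1 = 0 ∧ (x : State K) 0 i.2 = (y : State K) 0 i.2) := fun h =>
        hw (by rw [huB i h, sub_self])
      have hpos : 0 < R.up i.1 i.2 x / Λ := by
        have h1 := hua i
        have h2 : 0 ≤ ∑ j, u i j := Finset.sum_nonneg fun j _ => hu0 i j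
        rcases lt_or_eq_of_le (h2.trans h1) with h | h
        · exact h
        · exact absurd (by linarith) hw
      rw [hupx i hpos]
      exact hxy.add_left hne
    · have hpos : 0 < u i j := lt_of_le_of_ne (hu0 i j) (Ne.symm hw)
      rw [hupx i (hpos.trans_le ((hle j (hu0 i)).trans (hua i))),
        hupy j (hpos.trans_le ((hle i fun i => hu0 i j).trans (hub j)))]
      exact hxy.add_add fun hT => huT i j hT hw
    · exact absurd rfl hw
    · have hpos : 0 < R.down i.1 i.2 x / Λ := by
        have h1 := hvb i
        have h2 : 0 ≤ ∑ j, v j i := Finset.sum_nonneg fun j _ => hv0 j i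
        rcases lt_or_eq_of_le (h2.trans h1) with h | h
        · exact h
        · exact absurd (by linarith) hw
      have he := hdownx i hpos
      rw [← he] at hxy
      exact hxy.of_add_left
    · exact absurd rfl hw
    · have hpos : 0 < v j i := lt_of_le_of_ne (hv0 j i) (Ne.symm hw)
      have hex := hdownx i (hpos.trans_le ((hle j fun j => hv0 j i).trans (hvb i)))
      have hey := hdowny j (hpos.trans_le ((hle i (hv0 j)).trans (hva j)))
      have hT := hvT j i
      rw [← hex, ← hey] at hxy hT
      exact hxy.of_add_add fun h => hT h hw

end Coupling

section CoupledStep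

variable {K : ℕ} {S : Set (State K)}

/-- The ordered pairs of states, on which the coupled chain lives. -/
abbrev OrderedPair (S : Set (State K)) : Type := {p : S × S // Prec (p.1 : State K) p.2}

/-- The coupling of the moves, as a law on the ordered pairs of states. -/
lemma exists_coupled_stepLaw {R R' : UnitRates S} {Λ : ℝ} (hΛ : 0 < Λ)
    (hR : Dominates Λ R) (e : OrderedPair S)
    (h : ∃ w : Move K → Move K → ℝ, (∀ m m', 0 ≤ w m m') ∧
      (∀ m, ∑ m', w m m' = moveProb R Λ e.1.1 m) ∧
      (∀ m', ∑ m, w m m' = moveProb R' Λ e.1.2 m') ∧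
      ∀ m m', w m m' ≠ 0 → Prec (move m e.1.1 : State K) (move m' e.1.2)) :
    ∃ μ : Measure (OrderedPair S), IsProbabilityMeasure μ ∧
      μ.map (fun e => e.1.1) = stepLaw R Λ e.1.1 ∧ μ.map (fun e => e.1.2) = stepLaw R' Λ e.1.2 := by
  classical
  obtain ⟨w, hw0, hw1, hw2, hwP⟩ := h
  set target : Move K → Move K → OrderedPair S := fun m m' =>
    if h : Prec (move m e.1.1 : State K) (move m' e.1.2) then ⟨(move m e.1.1, move m' e.1.2), h⟩
    else e with htarget
  set μ : Measure (OrderedPair S) :=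
    ∑ m, ∑ m', ENNReal.ofReal (w m m') • Measure.dirac (target m m') with hμ
  have hfst : μ.map (fun e => e.1.1) = stepLaw R Λ e.1.1 := by
    ext s hs
    rw [Measure.map_apply Measurable.of_discrete hs, hμ, stepLaw]
    simp only [Measure.coe_finsetSum, Finset.sum_apply, Measure.smul_apply, smul_eq_mul]
    refine Finset.sum_congr rfl fun m _ => ?_
    rw [← hw1, ENNReal.ofReal_sum_of_nonneg fun m' _ => hw0 m m', Finset.sum_mul]
    refine Finset.sum_congr rfl fun m' _ => ?_
    by_cases h0 : w m m' = 0
    · simp [h0]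
    · simp only [htarget, dif_pos (hwP m m' h0), Measure.dirac_apply]
      rfl
  have hsnd : μ.map (fun e => e.1.2) = stepLaw R' Λ e.1.2 := by
    ext s hs
    rw [Measure.map_apply Measurable.of_discrete hs, hμ, stepLaw, Finset.sum_comm]
    simp only [Measure.coe_finsetSum, Finset.sum_apply, Measure.smul_apply, smul_eq_mul]
    refine Finset.sum_congr rfl fun m' _ => ?_
    rw [← hw2, ENNReal.ofReal_sum_of_nonneg fun m _ => hw0 m m', Finset.sum_mul]
    refine Finset.sum_congr rfl fun m _ => ?_
    by_cases h0 : w m m' = 0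
    · simp [h0]
    · simp only [htarget, dif_pos (hwP m m' h0), Measure.dirac_apply]
      rfl
  refine ⟨μ, ⟨?_⟩, hfst, hsnd⟩
  have := isProbabilityMeasure_stepLaw hΛ hR e.1.1
  have h1 := congrArg (fun ν => ν Set.univ) hfst
  simpa [Measure.map_apply (Measurable.of_discrete (f := fun e : OrderedPair S => e.1.1))
    MeasurableSet.univ] using h1

end CoupledStep

/-! ### Comparison of the processes -/

section Comparison

variable {K : ℕ} {S : Set (State K)} {R : UnitRates S}

lemma map_eval_zero_path {E : Type*} [MeasurableSpace E] [DiscreteMeasurableSpace E] [Countable E]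
    {κ : E → Measure E} [∀ e, IsProbabilityMeasure (κ e)] {Λ : ℝ} [hΛ : Fact (0 < Λ)] (f : E → S)
    (ρ : Measure E) [IsProbabilityMeasure ρ] :
    (ρ.prod (noiseLaw κ Λ)).map (fun p => (path f p.1 p.2).eval 0) = ρ.map f := by
  have hfm : Measurable f := Measurable.of_discrete
  ext s hs
  have hm : Measurable fun p : E × Noise E => (path f p.1 p.2).eval 0 :=
    hfm.comp (measurable_stateAt _)
  rw [Measure.map_apply hfm hs, Measure.map_apply hm hs, Measure.prod_apply (hm hs),
    ← lintegral_indicator_one (hfm hs)]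
  refine lintegral_congr fun e => ?_
  have h0 := noiseLaw_stateAt κ Λ (t := ((0 : ℝ≥0) : ℝ)) le_rfl e (f ⁻¹' s)
  rw [NNReal.coe_zero, jumpLaw_zero, Measure.dirac_apply] at h0
  exact h0

/-- The expectation of a functional of a Markov process with rates `R` can be computed with the
constructed process. -/
lemma IsMarkovWithRates.integral_eq {Ω : Type*} [MeasurableSpace Ω] {P : Measure Ω}
    [IsProbabilityMeasure P] {X : Ω → SkorohodSpace S} (hX : IsMarkovWithRates R P X)
    {E : Type*} [MeasurableSpace E] [DiscreteMeasurableSpace E] [Countable E] {κ : E → Measure E}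
    [∀ e, IsProbabilityMeasure (κ e)] {Λ : ℝ} [hΛ : Fact (0 < Λ)] (hR : Dominates Λ R) {f : E → S}
    (hf : ∀ e, (κ e).map f = stepLaw R Λ (f e)) {ρ : Measure E} [IsProbabilityMeasure ρ]
    (hρ : P.map (fun ω => (X ω).eval 0) = ρ.map f) {φ : SkorohodSpace S → ℝ} (hφ : Measurable φ)
    {C : ℝ} (hC : ∀ a, |φ a| ≤ C) :
    ∫ ω, φ (X ω) ∂P = ∫ e, ∫ u, φ (path f e u) ∂(noiseLaw κ Λ) ∂ρ := by
  have hM := isMarkovWithRates_path hR hf ρ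
  have hlaw := hX.map_eq hM (hρ.trans (map_eval_zero_path f ρ).symm)
  have hint : Integrable (fun p => φ (path f p.1 p.2)) (ρ.prod (noiseLaw κ Λ)) :=
    Integrable.of_bound (hφ.comp hM.measurable).aestronglyMeasurable C
      (Eventually.of_forall fun p => hC _)
  rw [← integral_map (φ := X) hX.measurable.aemeasurable hφ.aestronglyMeasurable, hlaw,
    integral_map hM.measurable.aemeasurable hφ.aestronglyMeasurable, integral_prod _ hint]

/-- The law of the process started at a point does not depend on the chain it is built from. -/
lemma integral_path_eq {E : Type*} [MeasurableSpace E] [DiscreteMeasurableSpace E] [Countable E]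
    {κ : E → Measure E} [∀ e, IsProbabilityMeasure (κ e)] {Λ : ℝ} [hΛ : Fact (0 < Λ)]
    [∀ x, IsProbabilityMeasure (stepLaw R Λ x)]
    (hR : Dominates Λ R) {f : E → S} (hf : ∀ e, (κ e).map f = stepLaw R Λ (f e)) (e : E)
    {φ : SkorohodSpace S → ℝ} (hφ : Measurable φ) {C : ℝ} (hC : ∀ a, |φ a| ≤ C) :
    ∫ u, φ (path id (f e) u) ∂(noiseLaw (stepLaw R Λ) Λ) =
      ∫ u, φ (path f e u) ∂(noiseLaw κ Λ) := by
  have hM := isMarkovWithRates_path hR hf (Measure.dirac e)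
  have h0 := map_eval_zero_path (κ := κ) (Λ := Λ) f (Measure.dirac e)
  have h1 := hM.integral_eq hR hf h0 hφ hC
  have h2 := hM.integral_eq hR (κ := stepLaw R Λ) (f := id) (fun x => Measure.map_id)
    (ρ := Measure.dirac (f e)) (by rw [h0, Measure.map_id, Measure.map_dirac]) hφ hC
  rw [integral_dirac] at h1 h2
  rw [← h1, ← h2]

lemma norm_integral_le_of_abs_le {Ω : Type*} [MeasurableSpace Ω] (μ : Measure Ω)
    [IsProbabilityMeasure μ] {g : Ω → ℝ} {C : ℝ} (h : ∀ ω, |g ω| ≤ C) : |∫ ω, g ω ∂μ| ≤ C := by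
  simpa using norm_integral_le_of_norm_le_const (μ := μ) (f := g) (Eventually.of_forall h)

end Comparison

theorem theorem1 {K : ℕ} (S : Set (State K)) (R R' : UnitRates S)
    {Ω Ω' : Type*} [MeasurableSpace Ω] [MeasurableSpace Ω']
    (P : Measure Ω) [IsProbabilityMeasure P] (P' : Measure Ω') [IsProbabilityMeasure P']
    (X : Ω → SkorohodSpace S) (Y : Ω' → SkorohodSpace S)
    (hX : IsMarkovWithRates R P X) (hY : IsMarkovWithRates R' P' Y)
    (h_layer_up : ∀ x y : S, Prec (x : State K) y → ∀ k, (x : State K) 0 k = (y : State K) 0 k →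
      R.up 0 k x ≤ R'.up 0 k y)
    (h_layer_down : ∀ x y : S, Prec (x : State K) y → ∀ k, (x : State K) 0 k = (y : State K) 0 k →
      R'.down 0 k y ≤ R.down 0 k x)
    (h_total_up : ∀ x y : S, Prec (x : State K) y → total (x : State K) = total (y : State K) →
      ∑ i, ∑ k, R.up i k x ≤ ∑ i, ∑ k, R'.up i k y)
    (h_total_down : ∀ x y : S, Prec (x : State K) y → total (x : State K) = total (y : State K) →
      ∑ i, ∑ k, R'.down i k y ≤ ∑ i, ∑ k, R.down i k x)
    (h_init : StochLE (fun x y : S => Prec (x : State K) y)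
      P (fun ω => (X ω).eval 0) P' (fun ω => (Y ω).eval 0)) :
    StochLE PathPrec P X P' Y := by
  rintro φ hφ ⟨C, hC⟩ hmono
  obtain ⟨Λ₁, hΛ₁, hR₁⟩ := exists_dominates R
  obtain ⟨Λ₂, hΛ₂, hR₂⟩ := exists_dominates R'
  set Λ := max Λ₁ Λ₂ with hΛdef
  have hΛ : 0 < Λ := lt_max_of_lt_left hΛ₁
  have hfact : Fact (0 < Λ) := ⟨hΛ⟩
  have hR : Dominates Λ R := hR₁.mono hΛ₁ (le_max_left _ _)
  have hR' : Dominates Λ R' := hR₂.mono hΛ₂ (le_max_right _ _)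
  have hP := isProbabilityMeasure_stepLaw hΛ hR
  have hP' := isProbabilityMeasure_stepLaw hΛ hR'
  have hX0 : Measurable fun ω => (X ω).eval 0 := measurable_skorohod_iff.1 hX.measurable 0
  have hY0 : Measurable fun ω => (Y ω).eval 0 := measurable_skorohod_iff.1 hY.measurable 0
  have hρ := Measure.isProbabilityMeasure_map (μ := P) hX0.aemeasurable
  have hρ' := Measure.isProbabilityMeasure_map (μ := P') hY0.aemeasurable
  choose κ hκ hκ1 hκ2 using fun e : OrderedPair S => exists_coupled_stepLaw hΛ hR e
    (exists_moveProb_coupling hΛ hR hR' e.2 (h_layer_up _ _ e.2) (h_layer_down _ _ e.2)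
      (h_total_up _ _ e.2) (h_total_down _ _ e.2))
  -- The expectations of `φ` for the two processes started at a given point.
  set h : S → ℝ := fun x => ∫ u, φ (path id x u) ∂(noiseLaw (stepLaw R Λ) Λ) with hh
  set h' : S → ℝ := fun x => ∫ u, φ (path id x u) ∂(noiseLaw (stepLaw R' Λ) Λ) with hh'
  have hbd : ∀ x, |h x| ≤ C := fun x => norm_integral_le_of_abs_le _ fun u => hC _
  have hbd' : ∀ x, |h' x| ≤ C := fun x => norm_integral_le_of_abs_le _ fun u => hC _
  have hle : ∀ x y : S, Prec (x : State K) y → h x ≤ h' y := by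
    intro x y hxy
    have e1 := integral_path_eq hR hκ1 ⟨(x, y), hxy⟩ hφ hC
    have e2 := integral_path_eq hR' hκ2 ⟨(x, y), hxy⟩ hφ hC
    have hm : ∀ (f : OrderedPair S → S) e, Measurable fun u => path f e u := fun f e =>
      measurable_skorohod_iff.2 fun t => (Measurable.of_discrete (f := f)).comp
        ((measurable_stateAt t).comp (measurable_const.prodMk measurable_id))
    have hint : ∀ (f : OrderedPair S → S) e,
        Integrable (fun u => φ (path f e u)) (noiseLaw κ Λ) := fun f e =>
      Integrable.of_bound (hφ.comp (hm f e)).aestronglyMeasurable C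
        (Eventually.of_forall fun u => hC _)
    simp only [hh, hh']
    rw [e1, e2]
    exact integral_mono (hint _ _) (hint _ _) fun u => hmono _ _ fun t =>
      (stateAt (⟨(x, y), hxy⟩ : OrderedPair S) u t).2
  -- An increasing function between `h` and `h'`.
  set g : S → ℝ := fun x => ⨆ z : {z : S // Prec (z : State K) x}, h z with hg
  have hgbdd : ∀ x : S, BddAbove (Set.range fun z : {z : S // Prec (z : State K) x} => h z) :=
    fun x => ⟨C, by rintro _ ⟨z, rfl⟩; exact (abs_le.1 (hbd z)).2⟩
  have hrefl : ∀ x : State K, Prec x x := fun x => ⟨fun _ => le_rfl, le_rfl⟩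
  have hhg : ∀ x, h x ≤ g x := fun x =>
    le_ciSup (hgbdd x) (⟨x, hrefl x⟩ : {z : S // Prec (z : State K) x})
  have hgh : ∀ x, g x ≤ h' x := fun x => by
    have : Nonempty {z : S // Prec (z : State K) x} := ⟨⟨x, hrefl x⟩⟩
    exact ciSup_le fun z => hle _ _ z.2
  have hgmono : ∀ x y : S, Prec (x : State K) y → g x ≤ g y := by
    intro x y hxy
    have : Nonempty {z : S // Prec (z : State K) x} := ⟨⟨x, hrefl x⟩⟩
    refine ciSup_le fun z => le_ciSup (hgbdd y) (⟨z.1, ?_⟩ : {z : S // Prec (z : State K) y})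
    exact ⟨fun k => (z.2.1 k).trans (hxy.1 k), z.2.2.trans hxy.2⟩
  have hgC : ∀ x, |g x| ≤ C := fun x => abs_le.2
    ⟨(abs_le.1 (hbd x)).1.trans (hhg x), (hgh x).trans (abs_le.1 (hbd' x)).2⟩
  have hint : ∀ (ρ : Measure S) [IsProbabilityMeasure ρ] (k : S → ℝ), (∀ x, |k x| ≤ C) →
      Integrable k ρ := fun ρ _ k hk =>
    Integrable.of_bound Measurable.of_discrete.aestronglyMeasurable C (Eventually.of_forall hk)
  rw [hX.integral_eq hR (κ := stepLaw R Λ) (f := id) (fun x => Measure.map_id)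
      (ρ := P.map fun ω => (X ω).eval 0) Measure.map_id.symm hφ hC,
    hY.integral_eq hR' (κ := stepLaw R' Λ) (f := id) (fun x => Measure.map_id)
      (ρ := P'.map fun ω => (Y ω).eval 0) Measure.map_id.symm hφ hC]
  calc ∫ x, h x ∂(P.map fun ω => (X ω).eval 0)
      ≤ ∫ x, g x ∂(P.map fun ω => (X ω).eval 0) := integral_mono (hint _ _ hbd) (hint _ _ hgC) hhg
    _ = ∫ ω, g ((X ω).eval 0) ∂P :=
      integral_map hX0.aemeasurable Measurable.of_discrete.aestronglyMeasurable
    _ ≤ ∫ ω, g ((Y ω).eval 0) ∂P' := h_init g Measurable.of_discrete ⟨C, hgC⟩ hgmono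
    _ = ∫ x, g x ∂(P'.map fun ω => (Y ω).eval 0) :=
      (integral_map hY0.aemeasurable Measurable.of_discrete.aestronglyMeasurable).symm
    _ ≤ ∫ x, h' x ∂(P'.map fun ω => (Y ω).eval 0) :=
      integral_mono (hint _ _ hgC) (hint _ _ hbd') hgh
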